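/- For each $n$ let $X_n$ be a real symmetric $n\times n$ matrix with eigenvalues $\lambda_1(n)\ge\lambda_2(n)\ge\dots\ge\lambda_n(n)$, let $l_n$ be the multiplicity of $\lambda_1(n)=\lambda_{\max}(X_n)$, and let $\epsilon_n\in\mathbb R$. If $l_n<n$, put $\gamma_n=\lambda_1(n)-\lambda_{l_n+1}(n)$ and write $\lambda_1(n)-\lambda_j(n)=\gamma_n+\delta_{j,n}$ for $j>l_n$. Assume: A1. There are constants $l\in\mathbb N$ and $\gamma>0$ such that, for all sufficiently large $n$, $l_n\le l$, $l_n<n$ and $\gamma_n\ge\gamma$. A2. $\liminf_{n\to\infty}\epsilon_n>0$ and $\limsup_{n\to\infty}\epsilon_n<\infty$. A3. There is a constant $C$, independent of $n$, such that for all sufficiently large $n$ $$\frac1{\gamma^2}>\frac1n\sum_{j=l_n+1}^n\frac1{(\gamma_n+\delta_{j,n})^2}>\frac1n\sum_{j=l_n+1}^n\frac1{(\epsilon_n+\gamma_n+\delta_{j,n})^2}>C.$$ Let $z^{(n)}\sim\mathcal N(0,\mathbf I_n)$, let $X_n(\epsilon_n)=X_n+\frac{\epsilon_n}{n}z^{(n)}(z^{(n)})^T$,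 let $u_{1,n},\dots,u_{n,n}$ be any orthonormal basis of $\mathbb R^n$ with $X_nu_{j,n}=\lambda_j(n)u_{j,n}$, and let $\mathsf z_{j,n}=u_{j,n}^Tz^{(n)}$. Define $\epsilon_{0,n}$ by $\frac1{\epsilon_{0,n}}=\frac1n\sum_{j=l_n+1}^n\frac1{\gamma_n+\delta_{j,n}}$ and put $$\chi^2_{l_n}=\sum_{j=1}^{l_n}\mathsf z_{j,n}^2,\qquad \xi_{1,n}=\frac1{\sqrt n}\sum_{j=l_n+1}^n\frac{\mathsf z_{j,n}^2-1}{\gamma_n+\delta_{j,n}},\qquad \zeta_{1,n}=\frac1n\sum_{j=l_n+1}^n\frac{\mathsf z_{j,n}^2}{(\gamma_n+\delta_{j,n})^2}.$$ Here $Y_n=O_P(r_n)$ means that $Y_n/r_n$ is bounded in probability: for every $\delta>0$ there is $M$ such that $P(|Y_n|>Mr_n)\le\delta$ for all sufficiently large $n$. Then, for each $n$, $\mathsf z_{1,n},\dots,\mathsf z_{n,n}$ are i.i.d. $\mathcal N(0,1)$; $\xi_{1,n}=O_P(1)$ and $\zeta_{1,n}=O_P(1)$; and, as $n\to\infty$: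 1. If $0<\epsilon_n<\epsilon_{0,n}$ for all sufficiently large $n$ and $\liminf_{n\to\infty}[\epsilon_{0,n}-\epsilon_n]>0$, then $$\lambda_{\max}[X_n(\epsilon_n)]=\lambda_{\max}[X_n]+\frac{W_{1,n}}n+\frac{W_{2,n}}{n^{3/2}}+O_P\!\left(\frac1{n^2}\right),\quad W_{1,n}=\frac{\chi^2_{l_n}}{1/\epsilon_n-1/\epsilon_{0,n}},\quad W_{2,n}=\frac{W_{1,n}\,\xi_{1,n}}{1/\epsilon_n-1/\epsilon_{0,n}}.$$ 2. If $\epsilon_n=\epsilon_{0,n}$ for all sufficiently large $n$, then $$\lambda_{\max}[X_n(\epsilon_n)]=\lambda_{\max}[X_n]+\frac{W_{1,n}}{\sqrt n}+O_P\!\left(\frac1n\right),\quad W_{1,n}=\frac{\xi_{1,n}+\sqrt{\xi_{1,n}^2+4\chi^2_{l_n}\zeta_{1,n}}}{2\zeta_{1,n}}.$$ 3. If $\epsilon_n>\epsilon_{0,n}$ for all sufficiently large $n$ and $\liminf_{n\to\infty}[\epsilon_n-\epsilon_{0,n}]>0$, then for all sufficiently large $n$ the equation $$\frac1{\epsilon_n}=\frac1n\sum_{j=l_n+1}^n\frac1{t+\gamma_n+\delta_{j,n}}$$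 has a unique positive solution $t_{0,n}$, it satisfies $t_{0,n}\le(1-l_n/n)\epsilon_n$, and $$\lambda_{\max}[X_n(\epsilon_n)]=\lambda_{\max}[X_n]+t_{0,n}+\frac{W_{1,n}}{\sqrt n}+O_P\!\left(\frac1n\right),\quad W_{1,n}=\frac{\xi(t_{0,n})}{\zeta(t_{0,n})},$$ where $$\xi(t_{0,n})=\frac1{\sqrt n}\sum_{j=l_n+1}^n\frac{\mathsf z_{j,n}^2-1}{t_{0,n}+\gamma_n+\delta_{j,n}}=O_P(1),\qquad \zeta(t_{0,n})=\frac1n\sum_{j=l_n+1}^n\frac1{(t_{0,n}+\gamma_n+\delta_{j,n})^2}=O(1).$$ -/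

import Mathlib

open Filter Topology MeasureTheory ProbabilityTheory Matrix

noncomputable section

namespace RankOne

/-- The largest eigenvalue of a real symmetric matrix of size `n ≥ 1`. -/
def lambdaMax {n : ℕ} (M : Matrix (Fin n) (Fin n) ℝ) : ℝ := sSup (spectrum ℝ M)

/-- `eig hX j` is the `(j+1)`-th largest eigenvalue of the symmetric matrix `X`, counted with
multiplicity, so `eig hX 0 ≥ eig hX 1 ≥ …`. -/
def eig {n : ℕ} {X : Matrix (Fin n) (Fin n) ℝ} (hX : X.IsHermitian) (j : Fin n) : ℝ :=
  hX.eigenvalues₀ (Fin.cast (Fintype.card_fin n).symm j)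

/-- The multiplicity `l_n` of the largest eigenvalue. -/
def topMult {n : ℕ} {X : Matrix (Fin n) (Fin n) ℝ} (hX : X.IsHermitian) : ℕ :=
  (Finset.univ.filter fun j : Fin n => eig hX j = lambdaMax X).card

/-- The distance `λ₁ - λ_{j+1}` to the largest eigenvalue. For indices beyond the multiplicity of
the largest eigenvalue this is `γ_n + δ_{j+1,n}`; at the index `l_n` (the `(l_n+1)`-th eigenvalue)
it is `γ_n`. -/
def gap {n : ℕ} {X : Matrix (Fin n) (Fin n) ℝ} (hX : X.IsHermitian) (j : Fin n) : ℝ :=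
  lambdaMax X - eig hX j

/-- The indices of the eigenvalues `λ_{l_n+1}, …, λ_n`. -/
def tail {n : ℕ} {X : Matrix (Fin n) (Fin n) ℝ} (hX : X.IsHermitian) : Finset (Fin n) :=
  Finset.univ.filter fun j => topMult hX ≤ (j : ℕ)

/-- The indices of the eigenvalues `λ_1, …, λ_{l_n}`. -/
def head {n : ℕ} {X : Matrix (Fin n) (Fin n) ℝ} (hX : X.IsHermitian) : Finset (Fin n) :=
  Finset.univ.filter fun j => (j : ℕ) < topMult hX

/-- `n⁻¹ ∑_{j > l_n} 1 / (t + γ_n + δ_{j,n})`. -/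
def invMean {n : ℕ} {X : Matrix (Fin n) (Fin n) ℝ} (hX : X.IsHermitian) (t : ℝ) : ℝ :=
  (1 / (n : ℝ)) * ∑ j ∈ tail hX, 1 / (t + gap hX j)

/-- `n⁻¹ ∑_{j > l_n} 1 / (t + γ_n + δ_{j,n})²`. -/
def invSqMean {n : ℕ} {X : Matrix (Fin n) (Fin n) ℝ} (hX : X.IsHermitian) (t : ℝ) : ℝ :=
  (1 / (n : ℝ)) * ∑ j ∈ tail hX, 1 / (t + gap hX j) ^ 2

/-- The critical value `ε_{0,n}`, with `1 / ε_{0,n} = n⁻¹ ∑_{j > l_n} 1 / (γ_n + δ_{j,n})`. -/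
def epsCrit {n : ℕ} {X : Matrix (Fin n) (Fin n) ℝ} (hX : X.IsHermitian) : ℝ :=
  1 / invMean hX 0

/-- The matrix `X + (ε / n) v vᵀ`. -/
def perturb {n : ℕ} (X : Matrix (Fin n) (Fin n) ℝ) (ε : ℝ) (v : EuclideanSpace ℝ (Fin n)) :
    Matrix (Fin n) (Fin n) ℝ :=
  X + (ε / (n : ℝ)) • Matrix.vecMulVec v.ofLp v.ofLp

/-- `b` is an orthonormal basis of eigenvectors of `X`, ordered by decreasing eigenvalues. -/
def IsEigenbasis {n : ℕ} {X : Matrix (Fin n) (Fin n) ℝ} (hX : X.IsHermitian)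
    (b : OrthonormalBasis (Fin n) ℝ (EuclideanSpace ℝ (Fin n))) : Prop :=
  ∀ j, X *ᵥ (b j).ofLp = eig hX j • (b j).ofLp

/-- The coordinate of the vector `v` along the `j`-th vector of the basis `b`. -/
def coord {n : ℕ} (b : OrthonormalBasis (Fin n) ℝ (EuclideanSpace ℝ (Fin n)))
    (v : EuclideanSpace ℝ (Fin n)) (j : Fin n) : ℝ :=
  inner ℝ (b j) v

section Statistics

variable {n : ℕ} {X : Matrix (Fin n) (Fin n) ℝ} (hX : X.IsHermitian)
  (b : OrthonormalBasis (Fin n) ℝ (EuclideanSpace ℝ (Fin n))) (ε t : ℝ)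
  (v : EuclideanSpace ℝ (Fin n))

/-- `χ²_{l_n} = ∑_{j ≤ l_n} z_j²`. -/
def chiSq : ℝ := ∑ j ∈ head hX, coord b v j ^ 2

/-- `ξ(t) = n^{-1/2} ∑_{j > l_n} (z_j² - 1) / (t + γ_n + δ_{j,n})`; `ξ_{1,n}` is `ξ(0)`. -/
def xi : ℝ :=
  (1 / √(n : ℝ)) * ∑ j ∈ tail hX, (coord b v j ^ 2 - 1) / (t + gap hX j)

/-- `ζ_{1,n} = n⁻¹ ∑_{j > l_n} z_j² / (γ_n + δ_{j,n})²`. -/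
def zetaOne : ℝ :=
  (1 / (n : ℝ)) * ∑ j ∈ tail hX, coord b v j ^ 2 / (gap hX j) ^ 2

/-- `W_{1,n}` below the critical value. -/
def subW₁ : ℝ := chiSq hX b v / (1 / ε - 1 / epsCrit hX)

/-- `W_{2,n}` below the critical value. -/
def subW₂ : ℝ := subW₁ hX b ε v * xi hX b 0 v / (1 / ε - 1 / epsCrit hX)

/-- `W_{1,n}` at the critical value. -/
def critW : ℝ :=
  (xi hX b 0 v + √(xi hX b 0 v ^ 2 + 4 * chiSq hX b v * zetaOne hX b v)) / (2 * zetaOne hX b v)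

/-- `W_{1,n} = ξ(t) / ζ(t)` above the critical value, to be used with `t = t_{0,n}`. -/
def superW : ℝ := xi hX b t v / invSqMean hX t

end Statistics

/-- `Y_n = O_P(r_n)`: the ratios `Y_n / r_n` are bounded in probability. The random variables
`Y_n` may live on different probability spaces. -/
def IsBigOP {Ω : ℕ → Type*} [∀ n, MeasurableSpace (Ω n)] (P : ∀ n, Measure (Ω n))
    (Y : ∀ n, Ω n → ℝ) (r : ℕ → ℝ) : Prop :=
  ∀ δ : ENNReal, 0 < δ → ∃ M : ℝ, ∀ᶠ n in atTop, P n {ω | M * |r n| < |Y n ω|} ≤ δ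

end RankOne

end

/-! Write `μ = λmax(X + (ε/n) z zᵀ) - λmax(X)` and `u = 1/√n`. In eigencoordinates of `X` the
rank-one eigenvalue problem collapses to one scalar equation, `χ² u² = μ (1/ε - F(μ))` with `F` =
`wMean`, and the Rayleigh principle adds `μ ≥ 0` and `F(μ) ≤ 1/ε`, which select the correct root
(`secular`). Two exact identities make it tractable: `F(s) - F(t) = (t - s) G(s,t)` with `G` =
`wMean₂` (`wMean_sub_wMean`), and `F(t)` is the deterministic mean `invMean` plus `ξ(t) u`
(`wMean_eq_add_xi`). Below criticality `1/ε - F(μ) = D - ξ u + μ G(0,μ)` with `D = 1/ε - 1/ε₀`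
bounded below, and expanding the reciprocal gives `μ`. At criticality `D = 0`, and `m = μ/u` solves
`m (m G(0,μ) - ξ) = χ²`, close to the quadratic whose nonnegative root is the claimed limit. Above,
one expands at `t₀`: `(μ - t₀) G(t₀,μ) = ξ u + ρ`, where `ρ = 1/ε - F(μ) = χ² u²/μ` is of order `u²`
because `μ` stays away from zero. In the last two regimes `G` is bounded below by Cauchy–Schwarz,
since the mean `F` is near `1/ε`. Probability enters only through the boundedness of `χ²`, the mean
of `z_j²`, `ξ` and `η`. On the event that these are at most `M`, every estimate is deterministic
with constants independent of `n`; `IsBigOP.of_control` turns this into `O_P`. -/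

namespace RankOne

/-! ### Boundedness in probability -/

section BigOP

variable {Ω : ℕ → Type*} [∀ n, MeasurableSpace (Ω n)] {P : ∀ n, Measure (Ω n)}

/-- The bridge from pointwise estimates to probability: once a control variable is bounded off an
event of small mass, a bound valid for each `ω` suffices, and measurability of `Y` is never needed.
-/
theorem IsBigOP.of_control {S Y : ∀ n, Ω n → ℝ} {r : ℕ → ℝ} (hS : IsBigOP P S fun _ => 1)
    (h : ∀ M : ℝ, 0 ≤ M → ∃ M' : ℝ, ∀ᶠ n in atTop, ∀ ω, |S n ω| ≤ M → |Y n ω| ≤ M' * |r n|) :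
    IsBigOP P Y r := by
  intro δ hδ
  obtain ⟨M, hM⟩ := hS δ hδ
  obtain ⟨M', hM'⟩ := h (max M 0) (le_max_right _ _)
  refine ⟨M', ?_⟩
  filter_upwards [hM, hM'] with n h1 h2
  refine (measure_mono fun ω hω => ?_).trans h1
  simp only [Set.mem_ofPred_eq, abs_one, mul_one] at hω ⊢
  by_contra! hc
  exact absurd (h2 ω (hc.trans (le_max_left _ _))) (not_le.2 hω)

theorem IsBigOP.abs {Y : ∀ n, Ω n → ℝ} {r : ℕ → ℝ} (hY : IsBigOP P Y r) :
    IsBigOP P (fun n ω => |Y n ω|) r := by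
  simpa only [IsBigOP, abs_abs] using hY

theorem IsBigOP.add {Y Z : ∀ n, Ω n → ℝ} {r : ℕ → ℝ} (hY : IsBigOP P Y r) (hZ : IsBigOP P Z r) :
    IsBigOP P (fun n ω => Y n ω + Z n ω) r := by
  intro δ hδ
  have hδ2 : 0 < δ / 2 := ENNReal.half_pos hδ.ne'
  obtain ⟨M, hM⟩ := hY _ hδ2
  obtain ⟨M', hM'⟩ := hZ _ hδ2
  refine ⟨M + M', ?_⟩
  filter_upwards [hM, hM'] with n h1 h2
  have hsub : {ω | (M + M') * |r n| < |Y n ω + Z n ω|} ⊆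
      {ω | M * |r n| < |Y n ω|} ∪ {ω | M' * |r n| < |Z n ω|} := by
    intro ω hω
    simp only [Set.mem_ofPred_eq, Set.mem_union] at hω ⊢
    by_contra! hc
    have := abs_add_le (Y n ω) (Z n ω)
    linarith [hc.1, hc.2, add_mul M M' |r n|]
  calc P n _ ≤ P n _ := measure_mono hsub
    _ ≤ P n _ + P n _ := measure_union_le _ _
    _ ≤ δ / 2 + δ / 2 := add_le_add h1 h2
    _ = δ := ENNReal.add_halves δ

/-- Markov's inequality at the level `(|V| + 1) / δ`; the added `1` keeps the level positive so that
it can be cancelled. -/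
theorem isBigOP_one_of_integral_le [∀ n, IsProbabilityMeasure (P n)] {Y : ∀ n, Ω n → ℝ} {V : ℝ}
    (h0 : ∀ n ω, 0 ≤ Y n ω)
    (h : ∀ᶠ n in atTop, Integrable (Y n) (P n) ∧ ∫ ω, Y n ω ∂P n ≤ V) :
    IsBigOP P Y fun _ => 1 := by
  intro δ hδ
  rcases eq_or_ne δ ⊤ with rfl | hδt
  · exact ⟨0, by simp⟩
  have hd : 0 < δ.toReal := ENNReal.toReal_pos hδ.ne' hδt
  have hM : 0 < (|V| + 1) / δ.toReal := by positivity
  refine ⟨(|V| + 1) / δ.toReal, ?_⟩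
  filter_upwards [h] with n hn
  have h1 := mul_meas_ge_le_integral_of_nonneg (Eventually.of_forall (h0 n)) hn.1
    ((|V| + 1) / δ.toReal)
  have h2 : (P n).real {ω | (|V| + 1) / δ.toReal ≤ Y n ω} ≤ δ.toReal := by
    have h3 : (|V| + 1) / δ.toReal * (P n).real {ω | (|V| + 1) / δ.toReal ≤ Y n ω} ≤
        (|V| + 1) / δ.toReal * δ.toReal := by
      rw [div_mul_cancel₀ _ hd.ne']
      linarith [hn.2, le_abs_self V]
    exact le_of_mul_le_mul_left h3 hM
  calc P n {ω | (|V| + 1) / δ.toReal * |(1 : ℝ)| < |Y n ω|}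
      ≤ P n {ω | (|V| + 1) / δ.toReal ≤ Y n ω} := measure_mono fun ω hω => by
        simp only [Set.mem_ofPred_eq, abs_one, mul_one, abs_of_nonneg (h0 n ω)] at hω ⊢
        exact hω.le
    _ = ENNReal.ofReal ((P n).real {ω | (|V| + 1) / δ.toReal ≤ Y n ω}) := by
        rw [ofReal_measureReal]
    _ ≤ ENNReal.ofReal δ.toReal := ENNReal.ofReal_le_ofReal h2
    _ = δ := ENNReal.ofReal_toReal hδt

theorem isBigOP_one_of_integral_sq_le [∀ n, IsProbabilityMeasure (P n)] {Y : ∀ n, Ω n → ℝ} {V : ℝ}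
    (h : ∀ᶠ n in atTop, Integrable (fun ω => Y n ω ^ 2) (P n) ∧ ∫ ω, Y n ω ^ 2 ∂P n ≤ V) :
    IsBigOP P Y fun _ => 1 := by
  refine (isBigOP_one_of_integral_le (fun n ω => sq_nonneg (Y n ω)) h).of_control
    fun M _ => ⟨M + 1, Eventually.of_forall fun n ω hω => ?_⟩
  rw [abs_of_nonneg (sq_nonneg _), ← sq_abs] at hω
  simp only [abs_one, mul_one]
  nlinarith [sq_nonneg (|Y n ω| - 1), abs_nonneg (Y n ω)]

end BigOP

/-! ### Gaussian coordinates and their moments -/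

section Gaussian

variable {Ω : Type*} [MeasurableSpace Ω] {P : Measure Ω} {n : ℕ}

/-- Rotation invariance: the standard Gaussian is the image of the product law under `x ↦ ∑ x_j b_j`
for any orthonormal basis, and taking coordinates inverts this map. -/
theorem hasLaw_coord_pi {z : Ω → EuclideanSpace ℝ (Fin n)}
    (hz : HasLaw z (stdGaussian (EuclideanSpace ℝ (Fin n))) P)
    (b : OrthonormalBasis (Fin n) ℝ (EuclideanSpace ℝ (Fin n))) :
    HasLaw (fun ω j => coord b (z ω) j) (Measure.pi fun _ : Fin n => gaussianReal 0 1) P := by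
  have hm : Measurable (fun (v : EuclideanSpace ℝ (Fin n)) j => coord b v j) := by
    unfold coord; fun_prop
  have h : HasLaw (fun (v : EuclideanSpace ℝ (Fin n)) j => coord b v j)
      (Measure.pi fun _ : Fin n => gaussianReal 0 1) (stdGaussian (EuclideanSpace ℝ (Fin n))) := by
    refine ⟨hm.aemeasurable, ?_⟩
    rw [stdGaussian_eq_map_pi_orthonormalBasis b, Measure.map_map hm (by fun_prop)]
    convert Measure.map_id
    ext x j
    simp only [Function.comp_apply, coord, id]
    rw [b.orthonormal.inner_right_fintype]
  exact h.fun_comp hz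

theorem hasLaw_coord {z : Ω → EuclideanSpace ℝ (Fin n)}
    (hz : HasLaw z (stdGaussian (EuclideanSpace ℝ (Fin n))) P)
    (b : OrthonormalBasis (Fin n) ℝ (EuclideanSpace ℝ (Fin n))) (j : Fin n) :
    HasLaw (fun ω => coord b (z ω) j) (gaussianReal 0 1) P :=
  (measurePreserving_eval (fun _ : Fin n => gaussianReal 0 1) j).fun_comp_hasLaw
    (hasLaw_coord_pi hz b)

theorem iIndepFun_coord [IsProbabilityMeasure P] {z : Ω → EuclideanSpace ℝ (Fin n)}
    (hz : HasLaw z (stdGaussian (EuclideanSpace ℝ (Fin n))) P)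
    (b : OrthonormalBasis (Fin n) ℝ (EuclideanSpace ℝ (Fin n))) :
    iIndepFun (fun j ω => coord b (z ω) j) P :=
  (iIndepFun_iff_hasLaw_pi_pi (hasLaw_coord hz b)).2 (hasLaw_coord_pi hz b)

theorem memLp_two_sq_sub_one_gaussianReal :
    MemLp (fun x : ℝ => x ^ 2 - 1) 2 (gaussianReal 0 1) := by
  have h : MemLp (fun x : ℝ => x) 4 (gaussianReal 0 1) := memLp_id_gaussianReal' 4 (by simp)
  have h2 : MemLp (fun x : ℝ => x * x) 2 (gaussianReal 0 1) := by
    have : ENNReal.HolderTriple 4 4 2 := ⟨by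
      rw [show (4 : ENNReal) = 2 * 2 by norm_num, ENNReal.mul_inv (by simp) (by simp), ← mul_add,
        ENNReal.inv_two_add_inv_two, mul_one]⟩
    exact h.mul' h
  simp_rw [sq]
  exact h2.sub (memLp_const 1)

theorem integral_sq_gaussianReal : ∫ x, x ^ 2 ∂gaussianReal 0 1 = 1 := by
  have h := variance_of_integral_eq_zero (μ := gaussianReal 0 1) (X := id) aemeasurable_id
    (by simp)
  rw [variance_id_gaussianReal] at h
  simpa using h.symm

theorem integrable_sq_gaussianReal : Integrable (fun x : ℝ => x ^ 2) (gaussianReal 0 1) :=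
  (memLp_id_gaussianReal' 2 (by simp)).integrable_sq

theorem integrable_sq_of_hasLaw {Y : Ω → ℝ} (hY : HasLaw Y (gaussianReal 0 1) P) :
    Integrable (fun ω => Y ω ^ 2) P := by
  have h := integrable_sq_gaussianReal
  rw [← hY.map_eq] at h
  exact h.comp_aemeasurable hY.aemeasurable

theorem integral_sq_of_hasLaw {Y : Ω → ℝ} (hY : HasLaw Y (gaussianReal 0 1) P) :
    ∫ ω, Y ω ^ 2 ∂P = 1 := by
  have h := hY.integral_comp (f := fun x : ℝ => x ^ 2) (by fun_prop)
  rw [integral_sq_gaussianReal] at h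
  exact h

theorem memLp_two_sq_sub_one {Y : Ω → ℝ} (hY : HasLaw Y (gaussianReal 0 1) P) :
    MemLp (fun ω => Y ω ^ 2 - 1) 2 P := by
  have h := memLp_two_sq_sub_one_gaussianReal
  rw [← hY.map_eq] at h
  exact h.comp_of_map hY.aemeasurable

/-- Second moment of a weighted sum of centred squares of independent standard Gaussians. -/
theorem integral_sq_weighted_sum [IsProbabilityMeasure P] {Z : Fin n → Ω → ℝ}
    (hZ : ∀ j, HasLaw (Z j) (gaussianReal 0 1) P)
    (hi : iIndepFun Z P) (a : Fin n → ℝ) (s : Finset (Fin n)) :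
    Integrable (fun ω => (∑ j ∈ s, a j * (Z j ω ^ 2 - 1)) ^ 2) P ∧
    ∫ ω, (∑ j ∈ s, a j * (Z j ω ^ 2 - 1)) ^ 2 ∂P =
      (∑ j ∈ s, a j ^ 2) * Var[fun x => x ^ 2 - 1; gaussianReal 0 1] := by
  have hm : ∀ j, MemLp (fun ω => a j * (Z j ω ^ 2 - 1)) 2 P := fun j =>
    (memLp_two_sq_sub_one (hZ j)).const_mul _
  have hsum : MemLp (fun ω => ∑ j ∈ s, a j * (Z j ω ^ 2 - 1)) 2 P :=
    memLp_finsetSum s fun j _ => hm j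
  refine ⟨hsum.integrable_sq, ?_⟩
  have hmean : ∫ ω, ∑ j ∈ s, a j * (Z j ω ^ 2 - 1) ∂P = 0 := by
    rw [integral_finsetSum _ fun j _ => (hm j).integrable (by norm_num)]
    refine Finset.sum_eq_zero fun j _ => ?_
    rw [integral_const_mul, integral_sub (integrable_sq_of_hasLaw (hZ j)) (integrable_const _),
      integral_sq_of_hasLaw (hZ j)]
    simp
  -- The sum is centred, so its second moment is its variance, which is additive by independence.
  rw [← variance_of_integral_eq_zero hsum.aemeasurable hmean]
  have hind := hi.comp (fun j x => a j * (x ^ 2 - 1)) fun j => by fun_prop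
  have hv := IndepFun.variance_sum (X := fun j ω => a j * (Z j ω ^ 2 - 1)) (s := s)
    (fun j _ => hm j) fun i _ j _ hij => hind.indepFun hij
  have he : (fun ω => ∑ j ∈ s, a j * (Z j ω ^ 2 - 1)) =
      ∑ j ∈ s, fun ω => a j * (Z j ω ^ 2 - 1) := by
    ext ω; simp
  rw [he, hv, Finset.sum_mul]
  refine Finset.sum_congr rfl fun j _ => ?_
  rw [variance_const_mul, ← (hZ j).map_eq, variance_map (by fun_prop) (hZ j).aemeasurable]
  rfl

end Gaussian

/-! ### Control variables bounded in probability -/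

section Controls

variable {Ω : ℕ → Type*} [∀ n, MeasurableSpace (Ω n)] {P : ∀ n, Measure (Ω n)}
  [∀ n, IsProbabilityMeasure (P n)] {Z : ∀ n, Fin n → Ω n → ℝ}

/-- At most `n` independent centred terms, each of variance at most `K² V`, are normalised by `1/n`
in the second moment, so that moment is bounded uniformly in `n`. -/
theorem isBigOP_weighted_sum (hZ : ∀ n j, HasLaw (Z n j) (gaussianReal 0 1) (P n))
    (hi : ∀ n, iIndepFun (Z n) (P n)) (a : ∀ n, Fin n → ℝ) (s : ∀ n, Finset (Fin n)) (K : ℝ)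
    (ha : ∀ᶠ n in atTop, ∀ j ∈ s n, |a n j| ≤ K) :
    IsBigOP P (fun n ω => (1 / √(n : ℝ)) * ∑ j ∈ s n, a n j * (Z n j ω ^ 2 - 1))
      fun _ => 1 := by
  set V := Var[fun x : ℝ => x ^ 2 - 1; gaussianReal 0 1] with hV
  have hV0 : 0 ≤ V := variance_nonneg _ _
  refine isBigOP_one_of_integral_sq_le (V := K ^ 2 * V) ?_
  filter_upwards [ha, eventually_gt_atTop 0] with n hn hpos
  have hn' : (0 : ℝ) < n := by exact_mod_cast hpos
  obtain ⟨h1, h2⟩ := integral_sq_weighted_sum (hZ n) (hi n) (a n) (s n)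
  simp_rw [mul_pow]
  refine ⟨h1.const_mul _, ?_⟩
  rw [integral_const_mul, h2, div_pow, Real.sq_sqrt hn'.le, one_pow, ← mul_assoc]
  refine mul_le_mul_of_nonneg_right ?_ hV0
  have h3 : ∑ j ∈ s n, a n j ^ 2 ≤ ∑ j : Fin n, K ^ 2 :=
    (Finset.sum_le_sum fun j hj => sq_le_sq.2 ((hn j hj).trans (le_abs_self K))).trans
      (Finset.sum_le_sum_of_subset_of_nonneg (Finset.subset_univ _) fun _ _ _ => sq_nonneg K)
  simp only [Finset.sum_const, Finset.card_univ, Fintype.card_fin, nsmul_eq_mul] at h3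
  rw [one_div_mul_eq_div, div_le_iff₀ hn']
  linarith

theorem isBigOP_sum_sq (hZ : ∀ n j, HasLaw (Z n j) (gaussianReal 0 1) (P n))
    (w : ℕ → ℝ) (hw : ∀ n, 0 ≤ w n) (s : ∀ n, Finset (Fin n)) (K : ℝ)
    (ha : ∀ᶠ n in atTop, w n * (s n).card ≤ K) :
    IsBigOP P (fun n ω => w n * ∑ j ∈ s n, Z n j ω ^ 2) fun _ => 1 := by
  refine isBigOP_one_of_integral_le (V := K)
    (fun n ω => mul_nonneg (hw n) (Finset.sum_nonneg fun _ _ => sq_nonneg _)) ?_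
  filter_upwards [ha] with n hn
  refine ⟨(integrable_finsetSum _ fun j _ => integrable_sq_of_hasLaw (hZ n j)).const_mul _, ?_⟩
  rw [integral_const_mul, integral_finsetSum _ fun j _ => integrable_sq_of_hasLaw (hZ n j)]
  simpa [integral_sq_of_hasLaw (hZ n _)] using hn

end Controls

end RankOne

namespace RankOne

/-! ### The largest eigenvalue in eigencoordinates and the secular equation -/

section Spectrum

variable {n : ℕ} {X : Matrix (Fin n) (Fin n) ℝ}

theorem isGreatest_lambdaMax (hX : X.IsHermitian) (hn : 0 < n) :
    IsGreatest (spectrum ℝ X) (lambdaMax X) := by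
  have : Nonempty (Fin n) := ⟨⟨0, hn⟩⟩
  have hne : (spectrum ℝ X).Nonempty := by
    rw [hX.spectrum_real_eq_range_eigenvalues]
    exact Set.range_nonempty _
  exact ⟨hne.csSup_mem X.finite_real_spectrum,
    fun _ hx => le_csSup X.finite_real_spectrum.bddAbove hx⟩

theorem range_eig (hX : X.IsHermitian) : Set.range (eig hX) = spectrum ℝ X := by
  rw [hX.spectrum_real_eq_range_eigenvalues]
  have h1 : eig hX = hX.eigenvalues₀ ∘ finCongr (Fintype.card_fin n).symm := rfl
  have h2 : hX.eigenvalues = hX.eigenvalues₀ ∘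
    (Fintype.equivOfCardEq (Fintype.card_fin _)).symm := rfl
  rw [h1, h2, (Equiv.surjective _).range_comp, (Equiv.surjective _).range_comp]

theorem eig_antitone (hX : X.IsHermitian) : Antitone (eig hX) := fun _ _ hij =>
  hX.eigenvalues₀_antitone (by simpa using hij)

theorem gap_nonneg (hX : X.IsHermitian) (j : Fin n) : 0 ≤ gap hX j :=
  sub_nonneg.2 ((isGreatest_lambdaMax hX j.pos).2 (range_eig hX ▸ Set.mem_range_self j))

theorem gap_mono (hX : X.IsHermitian) : Monotone (gap hX) := fun _ _ hij =>
  sub_le_sub_left (eig_antitone hX hij) _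

theorem topMult_pos (hX : X.IsHermitian) (hn : 0 < n) : 0 < topMult hX := by
  obtain ⟨j, hj⟩ : lambdaMax X ∈ Set.range (eig hX) :=
    range_eig hX ▸ (isGreatest_lambdaMax hX hn).1
  exact Finset.card_pos.2 ⟨j, by simpa using hj⟩

/-- If the `j`-th gap were positive, antitonicity would place all maximal eigenvalues at indices
below `j`, forcing the multiplicity to be at most `j`. -/
theorem gap_eq_zero_of_mem_head (hX : X.IsHermitian) {j : Fin n} (hj : j ∈ head hX) :
    gap hX j = 0 := by
  by_contra hne
  have hlt : eig hX j < lambdaMax X :=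
    lt_of_le_of_ne (sub_nonneg.1 (gap_nonneg hX j)) fun h => hne (sub_eq_zero.2 h.symm)
  have hsub : (Finset.univ.filter fun i : Fin n => eig hX i = lambdaMax X) ⊆ Finset.Iio j := by
    intro i hi
    rw [Finset.mem_Iio]
    by_contra! hij
    have := eig_antitone hX hij
    simp only [Finset.mem_filter, Finset.mem_univ, true_and] at hi
    linarith
  have h1 := Finset.card_le_card hsub
  simp only [head, Finset.mem_filter, Finset.mem_univ, true_and] at hj
  rw [Fin.card_Iio] at h1
  exact absurd hj (not_lt.2 h1)

theorem sum_head_add_sum_tail (hX : X.IsHermitian) (f : Fin n → ℝ) :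
    ∑ j ∈ head hX, f j + ∑ j ∈ tail hX, f j = ∑ j, f j := by
  simpa [head, tail] using
    Finset.sum_filter_add_sum_filter_not Finset.univ (fun j : Fin n => (j : ℕ) < topMult hX) f

theorem card_head (hX : X.IsHermitian) : (head hX).card = topMult hX := by
  have h : topMult hX ≤ n :=
    (Finset.card_le_univ _).trans_eq (Fintype.card_fin n)
  rw [head, Fin.card_filter_val_lt, min_eq_right h]

theorem card_head_add_card_tail (hX : X.IsHermitian) :
    ((head hX).card : ℝ) + (tail hX).card = n := by
  simpa using sum_head_add_sum_tail hX fun _ => 1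

variable (b : OrthonormalBasis (Fin n) ℝ (EuclideanSpace ℝ (Fin n)))

theorem dotProduct_eq_sum_coord (v w : EuclideanSpace ℝ (Fin n)) :
    v.ofLp ⬝ᵥ w.ofLp = ∑ j, coord b v j * coord b w j := by
  have h := b.sum_inner_mul_inner v w
  rw [EuclideanSpace.inner_eq_star_dotProduct] at h
  simp only [star_trivial] at h
  rw [dotProduct_comm, ← h]
  simp only [coord, real_inner_comm]

theorem coord_mulVec (hX : X.IsHermitian) {j : Fin n} {e : ℝ}
    (hj : X *ᵥ (b j).ofLp = e • (b j).ofLp) (w : EuclideanSpace ℝ (Fin n)) :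
    coord b (WithLp.toLp 2 (X *ᵥ w.ofLp)) j = e * coord b w j := by
  have hT : Xᵀ = X := (conjTranspose_eq_transpose_of_trivial X).symm.trans hX
  simp only [coord, EuclideanSpace.inner_eq_star_dotProduct, star_trivial]
  rw [dotProduct_comm, dotProduct_mulVec, ← mulVec_transpose, hT, hj, smul_dotProduct,
    dotProduct_comm, smul_eq_mul]

/-- Rayleigh bound for the largest eigenvalue. -/
theorem dotProduct_mulVec_le (hX : X.IsHermitian) (w : EuclideanSpace ℝ (Fin n)) :
    w.ofLp ⬝ᵥ X *ᵥ w.ofLp ≤ lambdaMax X * (w.ofLp ⬝ᵥ w.ofLp) := by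
  have h1 := dotProduct_eq_sum_coord hX.eigenvectorBasis w (WithLp.toLp 2 (X *ᵥ w.ofLp))
  have h2 := dotProduct_eq_sum_coord hX.eigenvectorBasis w w
  simp only at h1
  rw [h1, h2, Finset.mul_sum]
  refine Finset.sum_le_sum fun j _ => ?_
  rw [coord_mulVec _ hX (hX.mulVec_eigenvectorBasis j)]
  have h3 := (isGreatest_lambdaMax hX j.pos).2 (hX.eigenvalues_mem_spectrum_real j)
  nlinarith [mul_self_nonneg (coord hX.eigenvectorBasis w j)]

theorem exists_eigenvector_lambdaMax (hX : X.IsHermitian) (hn : 0 < n) :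
    ∃ w : EuclideanSpace ℝ (Fin n), w ≠ 0 ∧ X *ᵥ w.ofLp = lambdaMax X • w.ofLp := by
  obtain ⟨j, hj⟩ : lambdaMax X ∈ Set.range hX.eigenvalues :=
    hX.spectrum_real_eq_range_eigenvalues ▸ (isGreatest_lambdaMax hX hn).1
  exact ⟨hX.eigenvectorBasis j, hX.eigenvectorBasis.orthonormal.ne_zero j,
    hj ▸ hX.mulVec_eigenvectorBasis j⟩

theorem isHermitian_perturb (hX : X.IsHermitian) (ε : ℝ) (v : EuclideanSpace ℝ (Fin n)) :
    (perturb X ε v).IsHermitian := by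
  have hT : Xᵀ = X := (conjTranspose_eq_transpose_of_trivial X).symm.trans hX
  ext i j
  have h := congrFun (congrFun hT i) j
  simp only [transpose_apply] at h
  simp [perturb, vecMulVec_apply, h, mul_comm]

theorem perturb_mulVec (ε : ℝ) (v w : EuclideanSpace ℝ (Fin n)) :
    perturb X ε v *ᵥ w.ofLp =
      X *ᵥ w.ofLp + (ε / n * ∑ j, coord b v j * coord b w j) • v.ofLp := by
  rw [perturb, add_mulVec, smul_mulVec, vecMulVec_mulVec, dotProduct_eq_sum_coord b]
  ext i
  simp
  ring

variable {b}

theorem coord_perturb_mulVec (hX : X.IsHermitian) (hb : IsEigenbasis hX b) (ε : ℝ)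
    (v w : EuclideanSpace ℝ (Fin n)) (j : Fin n) :
    coord b (WithLp.toLp 2 (perturb X ε v *ᵥ w.ofLp)) j =
      eig hX j * coord b w j + ε / n * (∑ j, coord b v j * coord b w j) * coord b v j := by
  rw [perturb_mulVec b, ← coord_mulVec b hX (hb j)]
  simp only [coord, WithLp.toLp_add, WithLp.toLp_smul, inner_add_right, inner_smul_right]

/-- Rayleigh bound for the perturbed matrix in the eigencoordinates of `X`. -/
theorem perturb_rayleigh (hX : X.IsHermitian) (hb : IsEigenbasis hX b) (ε : ℝ)
    (v : EuclideanSpace ℝ (Fin n)) (c : Fin n → ℝ) :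
    ε / n * (∑ j, coord b v j * c j) ^ 2 ≤
      ∑ j, (lambdaMax (perturb X ε v) - lambdaMax X + gap hX j) * c j ^ 2 := by
  set w : EuclideanSpace ℝ (Fin n) := ∑ j, c j • b j with hw
  have hc : ∀ j, coord b w j = c j := fun j => b.orthonormal.inner_right_fintype c j
  have h := dotProduct_mulVec_le (isHermitian_perturb hX ε v) w
  have h1 := dotProduct_eq_sum_coord b w (WithLp.toLp 2 (perturb X ε v *ᵥ w.ofLp))
  simp only [coord_perturb_mulVec hX hb, hc] at h1
  rw [h1, dotProduct_eq_sum_coord b w w] at h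
  simp only [hc] at h
  have h2 : ∑ j, c j * (eig hX j * c j + ε / n * (∑ j, coord b v j * c j) * coord b v j) =
      ∑ j, eig hX j * c j ^ 2 + ε / n * (∑ j, coord b v j * c j) ^ 2 := by
    have h3 : ε / n * (∑ j, coord b v j * c j) ^ 2 =
        ∑ i, ε / n * (∑ j, coord b v j * c j) * (coord b v i * c i) := by
      rw [← Finset.mul_sum]; ring
    rw [h3, ← Finset.sum_add_distrib]
    exact Finset.sum_congr rfl fun j _ => by ring
  have h4 : ∑ j, (lambdaMax (perturb X ε v) - lambdaMax X + gap hX j) * c j ^ 2 =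
      lambdaMax (perturb X ε v) * ∑ j, c j * c j - ∑ j, eig hX j * c j ^ 2 := by
    rw [Finset.mul_sum, ← Finset.sum_sub_distrib]
    exact Finset.sum_congr rfl fun j _ => by rw [gap]; ring
  linarith

theorem perturb_eigen (hX : X.IsHermitian) (hb : IsEigenbasis hX b) (hn : 0 < n) (ε : ℝ)
    (v : EuclideanSpace ℝ (Fin n)) :
    ∃ c : Fin n → ℝ, c ≠ 0 ∧ ∀ j, (lambdaMax (perturb X ε v) - lambdaMax X + gap hX j) * c j =
      ε / n * (∑ j, coord b v j * c j) * coord b v j := by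
  obtain ⟨w, hw0, hw⟩ := exists_eigenvector_lambdaMax (isHermitian_perturb hX ε v) hn
  refine ⟨fun j => coord b w j, fun h => hw0 ?_, fun j => ?_⟩
  · rw [← b.sum_repr' w]
    exact Finset.sum_eq_zero fun j _ => by
      rw [show inner ℝ (b j) w = 0 from congrFun h j, zero_smul]
  · have h := coord_perturb_mulVec hX hb ε v w j
    rw [hw] at h
    have h2 : coord b (WithLp.toLp 2 (lambdaMax (perturb X ε v) • w.ofLp)) j =
        lambdaMax (perturb X ε v) * coord b w j := by
      simp only [coord, WithLp.toLp_smul, inner_smul_right]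
    rw [h2] at h
    rw [gap]
    linarith

end Spectrum

/-- `n⁻¹ ∑_{j > l_n} z_j² / (t + γ_n + δ_{j,n})`. -/
noncomputable def wMean {n : ℕ} {X : Matrix (Fin n) (Fin n) ℝ} (hX : X.IsHermitian)
    (b : OrthonormalBasis (Fin n) ℝ (EuclideanSpace ℝ (Fin n))) (v : EuclideanSpace ℝ (Fin n))
    (t : ℝ) : ℝ :=
  (1 / (n : ℝ)) * ∑ j ∈ tail hX, coord b v j ^ 2 / (t + gap hX j)

/-- The secular equation for the largest eigenvalue of the perturbed matrix. -/
theorem secular {n : ℕ} {X : Matrix (Fin n) (Fin n) ℝ} (hX : X.IsHermitian)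
    {b : OrthonormalBasis (Fin n) ℝ (EuclideanSpace ℝ (Fin n))} (hb : IsEigenbasis hX b)
    (hn : 0 < n) {ε : ℝ} (hε : 0 < ε) (hg : ∀ j ∈ tail hX, 0 < gap hX j)
    (v : EuclideanSpace ℝ (Fin n)) {μ : ℝ}
    (hμ : μ = lambdaMax (perturb X ε v) - lambdaMax X) :
    0 ≤ μ ∧ wMean hX b v μ ≤ 1 / ε ∧
      chiSq hX b v / n = μ * (1 / ε - wMean hX b v μ) := by
  have hR := perturb_rayleigh hX hb ε v
  obtain ⟨c, hc0, hc⟩ := perturb_eigen hX hb hn ε v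
  rw [← hμ] at hR hc
  have hn' : (0 : ℝ) < n := by exact_mod_cast hn
  have hεn : 0 < ε / n := div_pos hε hn'
  set z := coord b v with hz
  have hχ0 : 0 ≤ chiSq hX b v := Finset.sum_nonneg fun _ _ => sq_nonneg _
  have hμ0 : 0 ≤ μ := by
    -- Testing the Rayleigh bound on a top eigenvector of `X` gives `μ ≥ 0`.
    have h0 : (⟨0, hn⟩ : Fin n) ∈ head hX := by
      simpa [head] using topMult_pos hX hn
    have h := hR (Pi.single ⟨0, hn⟩ 1)
    simp only [Pi.single_apply, mul_ite, mul_one, mul_zero, Finset.sum_ite_eq', Finset.mem_univ,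
      if_true, ite_pow, one_pow, ne_eq, OfNat.ofNat_ne_zero, not_false_eq_true, zero_pow,
      gap_eq_zero_of_mem_head hX h0, add_zero] at h
    exact (mul_nonneg hεn.le (sq_nonneg _)).trans h
  have hgp : ∀ j ∈ tail hX, 0 < μ + gap hX j := fun j hj => add_pos_of_nonneg_of_pos hμ0 (hg j hj)
  set S := ∑ j ∈ tail hX, z j ^ 2 / (μ + gap hX j) with hS
  have hS0 : 0 ≤ S := Finset.sum_nonneg fun j hj => div_nonneg (sq_nonneg _) (hgp j hj).le
  have hF : wMean hX b v μ = S / n := by rw [wMean, one_div_mul_eq_div]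
  have hSle : ε / n * S ≤ 1 := by
    -- This test vector makes both sides functions of `S` alone: the bound reads `(ε/n) S² ≤ S`.
    have h := hR fun j => if j ∈ tail hX then z j / (μ + gap hX j) else 0
    simp only [mul_ite, mul_zero, ite_pow, ne_eq, OfNat.ofNat_ne_zero, not_false_eq_true, zero_pow,
      Finset.sum_ite_mem, Finset.univ_inter] at h
    have h1 : ∑ j ∈ tail hX, z j * (z j / (μ + gap hX j)) = S :=
      Finset.sum_congr rfl fun j _ => by ring
    have h2 : ∑ j ∈ tail hX, (μ + gap hX j) * (z j / (μ + gap hX j)) ^ 2 = S :=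
      Finset.sum_congr rfl fun j hj => by
        have := (hgp j hj).ne'
        field_simp
    rw [h1, h2] at h
    rcases hS0.eq_or_lt with h0 | h0
    · rw [← h0]; simp
    · exact le_of_mul_le_mul_right (by linarith [sq S, mul_assoc (ε / n) S S]) h0
  refine ⟨hμ0, ?_, ?_⟩
  · rw [hF, le_div_iff₀ hε]
    calc S / n * ε = ε / n * S := by ring
      _ ≤ 1 := hSle
  rcases hμ0.eq_or_lt with h0 | h0
  -- When `μ = 0`, testing on the projection of `z` to the top eigenspace forces `χ² = 0`, so both
  -- sides vanish.
  · have h := hR fun j => if j ∈ head hX then z j else 0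
    simp only [mul_ite, mul_zero, ite_pow, ne_eq, OfNat.ofNat_ne_zero, not_false_eq_true, zero_pow,
      Finset.sum_ite_mem, Finset.univ_inter, ← h0, zero_add] at h
    have h3 : ∑ j ∈ head hX, gap hX j * z j ^ 2 = 0 :=
      Finset.sum_eq_zero fun j hj => by rw [gap_eq_zero_of_mem_head hX hj, zero_mul]
    have h1 : ∑ j ∈ head hX, z j * z j = chiSq hX b v :=
      Finset.sum_congr rfl fun j _ => (sq _).symm
    rw [h1, h3] at h
    have h2 : chiSq hX b v ^ 2 ≤ 0 := by
      by_contra! h3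
      exact absurd (mul_pos hεn h3) (not_lt.2 h)
    rw [pow_eq_zero_iff two_ne_zero |>.1 (le_antisymm h2 (sq_nonneg _)), ← h0]
    simp
  -- When `μ > 0`, an eigenvector has coordinates proportional to `z_j / (μ + gap_j)`; pairing it
  -- with `z` and cancelling the nonzero `s` leaves the scalar equation.
  · have hall : ∀ j, 0 < μ + gap hX j := fun j => add_pos_of_pos_of_nonneg h0 (gap_nonneg hX j)
    set s := ∑ j, z j * c j with hs
    have hcj : ∀ j, c j = ε / n * s * z j / (μ + gap hX j) := fun j => by
      rw [eq_div_iff (hall j).ne', ← hc j]; ring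
    have hs0 : s ≠ 0 := fun h => hc0 (funext fun j => by rw [hcj j, h]; simp)
    have h1 : s = ε / n * s * (chiSq hX b v / μ + S) := by
      have h2 : ∑ j ∈ head hX, z j ^ 2 / (μ + gap hX j) = chiSq hX b v / μ := by
        rw [chiSq, Finset.sum_div]
        exact Finset.sum_congr rfl fun j hj => by rw [gap_eq_zero_of_mem_head hX hj, add_zero]
      rw [← h2, hS, sum_head_add_sum_tail, Finset.mul_sum]
      conv_lhs => rw [hs]
      exact Finset.sum_congr rfl fun j _ => by rw [hcj j]; ring
    have h2 : ε / n * (chiSq hX b v / μ + S) = 1 := by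
      apply mul_left_cancel₀ hs0
      linarith [mul_comm s (ε / n * (chiSq hX b v / μ + S)), mul_assoc (ε / n) s
        (chiSq hX b v / μ + S), mul_comm s (ε / n)]
    rw [hF]
    field_simp at h2 ⊢
    linarith

end RankOne

namespace RankOne

/-- `n⁻¹ ∑_{j > l_n} z_j² / ((s + γ_n + δ_{j,n}) (t + γ_n + δ_{j,n}))`. -/
noncomputable def wMean₂ {n : ℕ} {X : Matrix (Fin n) (Fin n) ℝ} (hX : X.IsHermitian)
    (b : OrthonormalBasis (Fin n) ℝ (EuclideanSpace ℝ (Fin n))) (v : EuclideanSpace ℝ (Fin n))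
    (s t : ℝ) : ℝ :=
  (1 / (n : ℝ)) * ∑ j ∈ tail hX, coord b v j ^ 2 / ((s + gap hX j) * (t + gap hX j))

/-- `n⁻¹ ∑_{j > l_n} z_j²`. -/
noncomputable def sqMean {n : ℕ} {X : Matrix (Fin n) (Fin n) ℝ} (hX : X.IsHermitian)
    (b : OrthonormalBasis (Fin n) ℝ (EuclideanSpace ℝ (Fin n)))
    (v : EuclideanSpace ℝ (Fin n)) : ℝ :=
  (1 / (n : ℝ)) * ∑ j ∈ tail hX, coord b v j ^ 2

/-- `n^{-1/2} ∑_{j > l_n} (z_j² - 1) / (t + γ_n + δ_{j,n})²`. -/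
noncomputable def eta {n : ℕ} {X : Matrix (Fin n) (Fin n) ℝ} (hX : X.IsHermitian)
    (b : OrthonormalBasis (Fin n) ℝ (EuclideanSpace ℝ (Fin n))) (t : ℝ)
    (v : EuclideanSpace ℝ (Fin n)) : ℝ :=
  (1 / √(n : ℝ)) * ∑ j ∈ tail hX, (coord b v j ^ 2 - 1) / (t + gap hX j) ^ 2

/-! ### Divided differences of the secular function -/

section Means

variable {n : ℕ} {X : Matrix (Fin n) (Fin n) ℝ} (hX : X.IsHermitian)
  (b : OrthonormalBasis (Fin n) ℝ (EuclideanSpace ℝ (Fin n))) (v : EuclideanSpace ℝ (Fin n))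
  {γ s t : ℝ}

theorem zetaOne_eq : zetaOne hX b v = wMean₂ hX b v 0 0 := by
  simp only [zetaOne, wMean₂, zero_add, sq]

theorem chiSq_nonneg : 0 ≤ chiSq hX b v := Finset.sum_nonneg fun _ _ => sq_nonneg _

theorem sqMean_nonneg : 0 ≤ sqMean hX b v :=
  mul_nonneg (by positivity) (Finset.sum_nonneg fun _ _ => sq_nonneg _)

theorem one_div_sqrt_mul_one_div_sqrt (x : ℕ) :
    1 / √(x : ℝ) * (1 / √(x : ℝ)) = 1 / (x : ℝ) := by
  rw [div_mul_div_comm, one_mul, Real.mul_self_sqrt x.cast_nonneg]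

theorem wMean_eq_add_xi : wMean hX b v t = invMean hX t + xi hX b t v * (1 / √(n : ℝ)) := by
  rw [xi, mul_right_comm, one_div_sqrt_mul_one_div_sqrt, wMean, invMean, ← mul_add,
    ← Finset.sum_add_distrib]
  congr 1
  exact Finset.sum_congr rfl fun j _ => by ring

theorem wMean₂_eq_add_eta :
    wMean₂ hX b v t t = invSqMean hX t + eta hX b t v * (1 / √(n : ℝ)) := by
  rw [eta, mul_right_comm, one_div_sqrt_mul_one_div_sqrt, wMean₂, invSqMean, ← mul_add,
    ← Finset.sum_add_distrib]
  congr 1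
  exact Finset.sum_congr rfl fun j _ => by ring

/-- Cauchy–Schwarz; it converts a lower bound on the secular function into one on its negative
derivative. -/
theorem wMean_sq_le :
    wMean hX b v t ^ 2 ≤ sqMean hX b v * wMean₂ hX b v t t := by
  have h := Finset.sum_mul_sq_le_sq_mul_sq (tail hX) (fun j => coord b v j)
    (fun j => coord b v j / (t + gap hX j))
  have h1 : ∑ j ∈ tail hX, coord b v j * (coord b v j / (t + gap hX j)) =
      ∑ j ∈ tail hX, coord b v j ^ 2 / (t + gap hX j) :=
    Finset.sum_congr rfl fun j _ => by ring
  have h2 : ∑ j ∈ tail hX, (coord b v j / (t + gap hX j)) ^ 2 =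
      ∑ j ∈ tail hX, coord b v j ^ 2 / ((t + gap hX j) * (t + gap hX j)) :=
    Finset.sum_congr rfl fun j _ => by rw [div_pow, ← sq]
  rw [h1, h2] at h
  rw [wMean, sqMean, wMean₂, mul_pow]
  calc _ ≤ (1 / (n : ℝ)) ^ 2 * _ := mul_le_mul_of_nonneg_left h (by positivity)
    _ = _ := by ring

variable (hγ : 0 < γ) (hg : ∀ j ∈ tail hX, γ ≤ gap hX j)
include hγ hg

/-- An exact divided difference, which replaces a Taylor expansion with remainder. -/
theorem wMean_sub_wMean (hs : 0 ≤ s) (ht : 0 ≤ t) :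
    wMean hX b v s - wMean hX b v t = (t - s) * wMean₂ hX b v s t := by
  rw [wMean, wMean, wMean₂, ← mul_sub, ← Finset.sum_sub_distrib, mul_left_comm,
    Finset.mul_sum _ _ (t - s)]
  congr 1
  refine Finset.sum_congr rfl fun j hj => ?_
  have h1 : s + gap hX j ≠ 0 := by linarith [hg j hj]
  have h2 : t + gap hX j ≠ 0 := by linarith [hg j hj]
  field_simp
  ring

theorem wMean₂_nonneg (hs : 0 ≤ s) (ht : 0 ≤ t) : 0 ≤ wMean₂ hX b v s t := by
  refine mul_nonneg (by positivity) (Finset.sum_nonneg fun j hj => ?_)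
  have h1 : 0 ≤ s + gap hX j := by linarith [hg j hj]
  have h2 : 0 ≤ t + gap hX j := by linarith [hg j hj]
  positivity

theorem wMean₂_le (hs : 0 ≤ s) (ht : 0 ≤ t) : wMean₂ hX b v s t ≤ sqMean hX b v / γ ^ 2 := by
  rw [wMean₂, sqMean, mul_div_assoc, Finset.sum_div]
  refine mul_le_mul_of_nonneg_left (Finset.sum_le_sum fun j hj => ?_) (by positivity)
  have h1 : γ ≤ s + gap hX j := by linarith [hg j hj]
  have h2 : γ ≤ t + gap hX j := by linarith [hg j hj]
  refine div_le_div_of_nonneg_left (sq_nonneg _) (by positivity) ?_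
  rw [sq]
  exact mul_le_mul h1 h2 hγ.le (hγ.le.trans h1)

/-- Each ratio `t / (t + gap_j)` is at most one; this yields the a priori bound on `μ`. -/
theorem mul_wMean_le (ht : 0 ≤ t) : t * wMean hX b v t ≤ sqMean hX b v := by
  rw [wMean, sqMean, mul_left_comm, Finset.mul_sum _ _ t]
  refine mul_le_mul_of_nonneg_left (Finset.sum_le_sum fun j hj => ?_) (by positivity)
  have h1 : 0 < t + gap hX j := by linarith [hg j hj]
  rw [mul_div_assoc', div_le_iff₀ h1]
  nlinarith [sq_nonneg (coord b v j), hg j hj]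

/-- Termwise `(t + gap_j) / (s + gap_j) ≤ 1 + t/γ`, so a lower bound at `(s, s)` passes to `(s, t)`.
-/
theorem wMean₂_self_le (hs : 0 ≤ s) (ht : 0 ≤ t) :
    wMean₂ hX b v s s ≤ (1 + t / γ) * wMean₂ hX b v s t := by
  rw [wMean₂, wMean₂, mul_left_comm, Finset.mul_sum _ _ (1 + t / γ)]
  refine mul_le_mul_of_nonneg_left (Finset.sum_le_sum fun j hj => ?_) (by positivity)
  have h1 : 0 < s + gap hX j := by linarith [hg j hj]
  have h2 : 0 < t + gap hX j := by linarith [hg j hj]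
  have h3 : t + gap hX j ≤ (1 + t / γ) * (s + gap hX j) := by
    have h4 : t ≤ t / γ * (s + gap hX j) := by
      rw [div_mul_eq_mul_div, le_div_iff₀ hγ]
      exact mul_le_mul_of_nonneg_left (by linarith [hg j hj]) ht
    linarith
  rw [mul_div_assoc', div_le_div_iff₀ (by positivity) (by positivity)]
  have h5 : 0 ≤ coord b v j ^ 2 * (s + gap hX j) := by positivity
  nlinarith [mul_le_mul_of_nonneg_left h3 h5]

theorem abs_wMean₂_sub_le (hs : 0 ≤ s) (ht : 0 ≤ t) :
    |wMean₂ hX b v s s - wMean₂ hX b v s t| ≤ |t - s| / γ * wMean₂ hX b v s s := by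
  rw [wMean₂, wMean₂, mul_left_comm, ← mul_sub, ← Finset.sum_sub_distrib,
    Finset.mul_sum _ _ (|t - s| / γ), abs_mul,
    abs_of_nonneg (by positivity : (0 : ℝ) ≤ 1 / (n : ℝ))]
  refine mul_le_mul_of_nonneg_left ((Finset.abs_sum_le_sum_abs _ _).trans
    (Finset.sum_le_sum fun j hj => ?_)) (by positivity)
  have h1 : 0 < s + gap hX j := by linarith [hg j hj]
  have h2 : 0 < t + gap hX j := by linarith [hg j hj]
  have h3 : coord b v j ^ 2 / ((s + gap hX j) * (s + gap hX j)) -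
      coord b v j ^ 2 / ((s + gap hX j) * (t + gap hX j)) =
      (t - s) / (t + gap hX j) * (coord b v j ^ 2 / ((s + gap hX j) * (s + gap hX j))) := by
    field_simp
    ring
  rw [h3, abs_mul, abs_div, abs_of_pos h2,
    abs_of_nonneg (div_nonneg (sq_nonneg (coord b v j)) (mul_self_nonneg (s + gap hX j)))]
  refine mul_le_mul_of_nonneg_right ?_ (by positivity)
  exact div_le_div_of_nonneg_left (abs_nonneg _) hγ (by linarith [hg j hj])

end Means

/-! ### Deterministic expansions of the scalar equation, with `u = 1/√n` -/

section Expansions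

/-- With `x = ξ u - R` and `E = D - x`, the identity `1/E = 1/D + x/D² + x²/(D² E)` isolates the two
claimed terms. The rest is of order `u⁴`, since `x = O(u)`, while `R ≤ μ B` and `μ = O(u²)` give `R
= O(u²)`. -/
theorem subcritical_expansion {μ χ ξ D R B M d u : ℝ} (hd : 0 < d) (hu : 0 < u) (hD : d ≤ D)
    (hχ0 : 0 ≤ χ) (hχ : χ ≤ M) (hξ : |ξ| ≤ M) (hB0 : 0 ≤ B) (hμ : 0 ≤ μ)
    (hR0 : 0 ≤ R) (hR : R ≤ μ * B) (hMu : M * u ≤ d / 2) (h : χ * u ^ 2 = μ * (D - ξ * u + R)) :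
    |μ - (χ / D * u ^ 2 + χ / D * ξ / D * u ^ 3)| ≤
      M * (2 * (M + B) ^ 2 + 2 * M * B) / d ^ 3 * u ^ 4 := by
  have hM : 0 ≤ M := hχ0.trans hχ
  have hD0 : 0 < D := hd.trans_le hD
  have hξu : |ξ * u| ≤ M * u := by
    rw [abs_mul, abs_of_pos hu]
    exact mul_le_mul_of_nonneg_right hξ hu.le
  set E := D - ξ * u + R with hE
  have hE2 : d / 2 ≤ E := by linarith [le_abs_self (ξ * u)]
  have hE0 : 0 < E := by linarith
  have hμle : μ ≤ 2 * M / d * u ^ 2 := by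
    rw [div_mul_eq_mul_div, le_div_iff₀ hd]
    nlinarith [mul_le_mul_of_nonneg_left hE2 hμ, mul_le_mul_of_nonneg_right hχ (sq_nonneg u)]
  have hRle : R ≤ 2 * M * B / d * u ^ 2 :=
    hR.trans ((mul_le_mul_of_nonneg_right hμle hB0).trans_eq (by ring))
  have hRle' : R ≤ B * u := by
    refine hRle.trans ?_
    rw [div_mul_eq_mul_div, div_le_iff₀ hd]
    nlinarith [mul_le_mul_of_nonneg_left hMu (mul_nonneg hB0 hu.le)]
  have hx : |ξ * u - R| ≤ (M + B) * u := by
    refine (abs_sub _ _).trans ?_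
    rw [abs_of_nonneg hR0]
    linarith
  have hx2 : (ξ * u - R) ^ 2 ≤ ((M + B) * u) ^ 2 :=
    sq_le_sq' (by linarith [abs_le.1 hx]) (abs_le.1 hx).2
  have hμE : μ = χ * u ^ 2 / E := by rw [eq_div_iff hE0.ne', h]
  have key : μ - (χ / D * u ^ 2 + χ / D * ξ / D * u ^ 3) =
      χ * u ^ 2 * ((ξ * u - R) ^ 2 / (D ^ 2 * E) - R / D ^ 2) := by
    rw [hμE]
    field_simp
    rw [hE]
    ring
  have hd2 : d ^ 2 ≤ D ^ 2 := pow_le_pow_left₀ hd.le hD 2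
  have h1 : (ξ * u - R) ^ 2 / (D ^ 2 * E) ≤ ((M + B) * u) ^ 2 / (d ^ 2 * (d / 2)) :=
    div_le_div₀ (sq_nonneg _) hx2 (by positivity)
      (mul_le_mul hd2 hE2 (by positivity) (by positivity))
  have h2 : R / D ^ 2 ≤ 2 * M * B / d * u ^ 2 / d ^ 2 :=
    div_le_div₀ (hR0.trans hRle) hRle (by positivity) hd2
  have h3 : 0 ≤ (ξ * u - R) ^ 2 / (D ^ 2 * E) := by positivity
  have h4 : 0 ≤ R / D ^ 2 := by positivity
  have h5 : |(ξ * u - R) ^ 2 / (D ^ 2 * E) - R / D ^ 2| ≤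
      ((M + B) * u) ^ 2 / (d ^ 2 * (d / 2)) + 2 * M * B / d * u ^ 2 / d ^ 2 := by
    rw [abs_le]; constructor <;> linarith
  rw [key, abs_mul, abs_of_nonneg (by positivity : 0 ≤ χ * u ^ 2)]
  calc χ * u ^ 2 * _ ≤ M * u ^ 2 *
        (((M + B) * u) ^ 2 / (d ^ 2 * (d / 2)) + 2 * M * B / d * u ^ 2 / d ^ 2) :=
        mul_le_mul (mul_le_mul_of_nonneg_right hχ (sq_nonneg u)) h5 (abs_nonneg _) (by positivity)
    _ = _ := by field_simp

/-- `W` satisfies `W (W ζ - ξ) = χ` with `W ζ ≥ ξ`, and `m` the same equation with `ζ'`. Subtracting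
gives `(m - W)(m ζ + (W ζ - ξ)) = m² (ζ - ζ')`, whose second factor is at least `m ζ`. -/
theorem critical_expansion {m χ ξ ζ ζ' κ : ℝ} (hm : 0 ≤ m) (hχ : 0 ≤ χ) (hζ : 0 < ζ)
    (hle : |ζ - ζ'| ≤ m * κ * ζ) (h1 : χ = m * (m * ζ' - ξ)) (h2 : ξ ≤ m * ζ') :
    |m - (ξ + √(ξ ^ 2 + 4 * χ * ζ)) / (2 * ζ)| ≤ m ^ 2 * κ := by
  set W := (ξ + √(ξ ^ 2 + 4 * χ * ζ)) / (2 * ζ) with hW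
  have hs0 : 0 ≤ ξ ^ 2 + 4 * χ * ζ := by positivity
  have hs := Real.sq_sqrt hs0
  have hsabs : |ξ| ≤ √(ξ ^ 2 + 4 * χ * ζ) := Real.abs_le_sqrt (by nlinarith [mul_nonneg hχ hζ.le])
  have h2W : 2 * ζ * W = ξ + √(ξ ^ 2 + 4 * χ * ζ) := by rw [hW]; field_simp
  have hWξ : 0 ≤ W * ζ - ξ := by linarith [le_abs_self ξ]
  have hWeq : W * (W * ζ - ξ) = χ := by
    have h3 : (2 * ζ * W - ξ) ^ 2 = ξ ^ 2 + 4 * χ * ζ := by rw [h2W, add_sub_cancel_left, hs]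
    have h4 : 4 * ζ * (W * (W * ζ - ξ) - χ) = 0 := by linarith
    have h5 := (mul_eq_zero.1 h4).resolve_left (by positivity)
    linarith
  rcases hm.eq_or_lt with h0 | h0
  -- The factor `m ζ` cannot be cancelled here, but then `χ = 0` and `ξ ≤ 0`, so `W = 0` as well.
  · rw [← h0] at h1 h2 ⊢
    have hχ0 : χ = 0 := by linarith
    have hξ0 : ξ ≤ 0 := by linarith
    have hW0 : W = 0 := by
      rw [hW, hχ0, mul_zero, zero_mul, add_zero, Real.sqrt_sq_eq_abs, abs_of_nonpos hξ0]
      simp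
    simp [hW0]
  · have h3 : (m - W) * (m * ζ + (W * ζ - ξ)) = m ^ 2 * (ζ - ζ') := by linarith
    have h4 : 0 < m * ζ + (W * ζ - ξ) := by positivity
    have h5 : |m - W| * (m * ζ + (W * ζ - ξ)) = m ^ 2 * |ζ - ζ'| := by
      rw [← abs_of_pos h4, ← abs_mul, h3, abs_mul, abs_of_nonneg (sq_nonneg m)]
    have h6 : |m - W| * (m * ζ) ≤ m ^ 2 * κ * (m * ζ) :=
      calc |m - W| * (m * ζ) ≤ |m - W| * (m * ζ + (W * ζ - ξ)) :=
            mul_le_mul_of_nonneg_left (by linarith) (abs_nonneg _)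
        _ = m ^ 2 * |ζ - ζ'| := h5
        _ ≤ m ^ 2 * (m * κ * ζ) := mul_le_mul_of_nonneg_left hle (sq_nonneg m)
        _ = _ := by ring
    exact le_of_mul_le_mul_right h6 (by positivity)

/-- The error satisfies `(y - (ξ/ζ) u) ζ = ρ - y (A - ζ)`. Here `ρ = O(u²)` because `t₀ + y` stays
above `c/2`, while `y` and `A - ζ` are both `O(u)`. -/
theorem supercritical_expansion {y t₀ ρ χ ξ η ζ A B M a c k γ u : ℝ} (ha : 0 < a) (hc : 0 < c)
    (hk : 0 < k) (hγ : 0 < γ) (hu : 0 < u) (hu1 : u ≤ 1) (hχ0 : 0 ≤ χ) (hχ : χ ≤ M) (hξ : |ξ| ≤ M)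
    (hη : |η| ≤ M) (hρ : 0 ≤ ρ) (ht : c ≤ t₀) (hA : a ≤ A) (hB : |B| ≤ M / γ ^ 2) (hζ : k ≤ ζ)
    (hBζ : B = ζ + η * u) (hAB : |B - A| ≤ |y| / γ * B) (hMu : M * u / a ≤ c / 2)
    (h1 : y * A = ξ * u + ρ) (h2 : χ * u ^ 2 = (t₀ + y) * ρ) :
    |y - ξ / ζ * u| ≤
      (2 * M / c + (M + 2 * M / c) / a * ((M + 2 * M / c) / a * M / γ ^ 3 + M)) / k * u ^ 2 := by
  have hM : 0 ≤ M := hχ0.trans hχ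
  have hA0 : 0 < A := ha.trans_le hA
  have hζ0 : 0 < ζ := hk.trans_le hζ
  have hξu : |ξ * u| ≤ M * u := by
    rw [abs_mul, abs_of_pos hu]
    exact mul_le_mul_of_nonneg_right hξ hu.le
  -- Since `ρ ≥ 0`, only the fluctuation `ξ u` can push `y` below zero, by at most `M u / a`.
  have hylow : -(c / 2) ≤ y := by
    by_contra! hlt
    have h3 : y * A ≤ y * a := mul_le_mul_of_nonpos_left hA (by linarith)
    rw [div_le_iff₀ ha] at hMu
    nlinarith [neg_abs_le (ξ * u)]
  have hμ : c / 2 ≤ t₀ + y := by linarith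
  have hρle : ρ ≤ 2 * M / c * u ^ 2 := by
    rw [div_mul_eq_mul_div, le_div_iff₀ hc]
    nlinarith [mul_le_mul_of_nonneg_right hμ hρ, mul_le_mul_of_nonneg_right hχ (sq_nonneg u)]
  have hu2 : u ^ 2 ≤ u := by nlinarith
  have hMc : 0 ≤ 2 * M / c := by positivity
  set Y := (M + 2 * M / c) / a with hY
  have hY0 : 0 ≤ Y := by positivity
  have hy : |y| ≤ Y * u := by
    rw [hY, div_mul_eq_mul_div, le_div_iff₀ ha]
    calc |y| * a ≤ |y| * A := mul_le_mul_of_nonneg_left hA (abs_nonneg _)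
      _ = |ξ * u + ρ| := by rw [← h1, abs_mul, abs_of_pos hA0]
      _ ≤ |ξ * u| + ρ := (abs_add_le _ _).trans_eq (by rw [abs_of_nonneg hρ])
      _ ≤ M * u + 2 * M / c * u :=
        add_le_add hξu (hρle.trans (mul_le_mul_of_nonneg_left hu2 hMc))
      _ = _ := by ring
  have hAζ : |A - ζ| ≤ (Y * M / γ ^ 3 + M) * u := by
    have h3 : |B - A| ≤ Y * u / γ * (M / γ ^ 2) :=
      calc |B - A| ≤ |y| / γ * B := hAB
        _ ≤ |y| / γ * (M / γ ^ 2) :=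
          mul_le_mul_of_nonneg_left ((le_abs_self B).trans hB) (by positivity)
        _ ≤ _ := by gcongr
    have h4 : |η * u| ≤ M * u := by
      rw [abs_mul, abs_of_pos hu]
      exact mul_le_mul_of_nonneg_right hη hu.le
    calc |A - ζ| = |η * u - (B - A)| := by rw [hBζ]; congr 1; ring
      _ ≤ |η * u| + |B - A| := abs_sub _ _
      _ ≤ M * u + Y * u / γ * (M / γ ^ 2) := add_le_add h4 h3
      _ = _ := by field_simp; ring
  have h5 : (y - ξ / ζ * u) * ζ = ρ - y * (A - ζ) := by
    have : (y - ξ / ζ * u) * ζ = y * ζ - ξ * u := by field_simp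
    rw [this]; linarith
  have h6 : |y - ξ / ζ * u| * ζ ≤ (2 * M / c + Y * (Y * M / γ ^ 3 + M)) * u ^ 2 :=
    calc |y - ξ / ζ * u| * ζ = |ρ - y * (A - ζ)| := by rw [← h5, abs_mul, abs_of_pos hζ0]
      _ ≤ ρ + |y| * |A - ζ| := (abs_sub _ _).trans_eq (by rw [abs_of_nonneg hρ, abs_mul])
      _ ≤ 2 * M / c * u ^ 2 + Y * u * ((Y * M / γ ^ 3 + M) * u) :=
        add_le_add hρle (mul_le_mul hy hAζ (abs_nonneg _) (by positivity))
      _ = _ := by ring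
  rw [div_mul_eq_mul_div _ k, le_div_iff₀ hk]
  exact (mul_le_mul_of_nonneg_left hζ (abs_nonneg _)).trans h6

end Expansions

end RankOne

namespace RankOne

theorem exists_pos_le_of_liminf {f : ℕ → ℝ}
    (h : (0 : EReal) < liminf (fun n => (f n : EReal)) atTop) :
    ∃ c : ℝ, 0 < c ∧ ∀ᶠ n in atTop, c ≤ f n := by
  obtain ⟨c, hc0, hc⟩ := EReal.lt_iff_exists_real_btwn.1 h
  refine ⟨c, by exact_mod_cast hc0, ?_⟩
  filter_upwards [eventually_lt_of_lt_liminf hc] with n hn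
  exact_mod_cast hn.le

theorem exists_pos_ge_of_limsup {f : ℕ → ℝ}
    (h : limsup (fun n => (f n : EReal)) atTop < ⊤) :
    ∃ K : ℝ, 0 < K ∧ ∀ᶠ n in atTop, f n ≤ K := by
  obtain ⟨c, hc, -⟩ := EReal.lt_iff_exists_real_btwn.1 h
  refine ⟨max c 1, by positivity, ?_⟩
  filter_upwards [eventually_lt_of_limsup_lt hc] with n hn
  exact le_max_of_le_left (by exact_mod_cast hn.le)

theorem eventually_mul_one_div_sqrt_le (M : ℝ) {δ : ℝ} (hδ : 0 < δ) :
    ∀ᶠ n : ℕ in atTop, M * (1 / √(n : ℝ)) ≤ δ := by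
  have h : Tendsto (fun n : ℕ => M * (1 / √(n : ℝ))) atTop (𝓝 (M * 0)) := by
    refine Tendsto.const_mul M ?_
    simp_rw [one_div]
    exact (Real.tendsto_sqrt_atTop.comp tendsto_natCast_atTop_atTop).inv_tendsto_atTop
  rw [mul_zero] at h
  exact h.eventually_le_const hδ

/-- The bounds, uniform in the size `n`, provided by the assumptions A1 and A2. -/
structure Regular {n : ℕ} {X : Matrix (Fin n) (Fin n) ℝ} (hX : X.IsHermitian) (l : ℕ)
    (γ e K ε : ℝ) : Prop where
  γ_pos : 0 < γ
  e_pos : 0 < e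
  topMult_le : topMult hX ≤ l
  topMult_lt : topMult hX < n
  le_gap : ∀ j ∈ tail hX, γ ≤ gap hX j
  le_eps : e ≤ ε
  eps_le : ε ≤ K

/-! ### The deterministic means and the supercritical equation -/

section InvMean

variable {n : ℕ} {X : Matrix (Fin n) (Fin n) ℝ} {hX : X.IsHermitian}
  {γ s t : ℝ}

theorem tail_nonempty (h : topMult hX < n) : (tail hX).Nonempty :=
  ⟨⟨topMult hX, h⟩, by simp [tail]⟩

theorem card_tail_div (hn : 0 < n) :
    1 / (n : ℝ) * (tail hX).card = 1 - (topMult hX : ℝ) / n := by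
  have hn' : (n : ℝ) ≠ 0 := by positivity
  have h := card_head_add_card_tail hX
  rw [card_head] at h
  field_simp
  linarith

theorem card_tail_le : ((tail hX).card : ℝ) ≤ n := by
  exact_mod_cast (Finset.card_le_univ _).trans_eq (Fintype.card_fin n)

/-- Cauchy–Schwarz with at most `n` terms. At a solution `t` of `1/ε = invMean t` it keeps the
denominator of `superW` above `1/ε²`. -/
theorem invMean_sq_le : invMean hX t ^ 2 ≤ invSqMean hX t := by
  have h := sq_sum_le_card_mul_sum_sq (s := tail hX) (f := fun j => 1 / (t + gap hX j))
  simp_rw [div_pow, one_pow] at h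
  have h0 : 0 ≤ ∑ j ∈ tail hX, 1 / (t + gap hX j) ^ 2 :=
    Finset.sum_nonneg fun j _ => by positivity
  rcases Nat.eq_zero_or_pos n with rfl | hn
  · simp [invMean, invSqMean]
  have hn' : (0 : ℝ) < n := by exact_mod_cast hn
  rw [invMean, invSqMean, mul_pow]
  calc _ ≤ (1 / (n : ℝ)) ^ 2 * (n * ∑ j ∈ tail hX, 1 / (t + gap hX j) ^ 2) :=
        mul_le_mul_of_nonneg_left (h.trans (mul_le_mul_of_nonneg_right card_tail_le h0))
          (by positivity)
    _ = _ := by field_simp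

variable (hγ : 0 < γ) (hg : ∀ j ∈ tail hX, γ ≤ gap hX j)
include hγ hg

theorem invMean_lt_invMean (h : topMult hX < n) (hs : 0 ≤ s) (hst : s < t) :
    invMean hX t < invMean hX s := by
  have hn' : (0 : ℝ) < n := by exact_mod_cast (Nat.zero_le _).trans_lt h
  refine mul_lt_mul_of_pos_left (Finset.sum_lt_sum_of_nonempty (tail_nonempty h) fun j hj => ?_)
    (by positivity)
  exact one_div_lt_one_div_of_lt (by linarith [hg j hj]) (by linarith)

theorem invMean_pos (h : topMult hX < n) (ht : 0 ≤ t) : 0 < invMean hX t := by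
  have hn' : (0 : ℝ) < n := by exact_mod_cast (Nat.zero_le _).trans_lt h
  refine mul_pos (by positivity) (Finset.sum_pos (fun j hj => ?_) (tail_nonempty h))
  have : 0 < t + gap hX j := by linarith [hg j hj]
  positivity

theorem mul_invMean_le (hn : 0 < n) (ht : 0 ≤ t) :
    t * invMean hX t ≤ 1 - (topMult hX : ℝ) / n := by
  rw [← card_tail_div hn, invMean, mul_left_comm, Finset.mul_sum _ _ t]
  refine mul_le_mul_of_nonneg_left ?_ (by positivity)
  calc ∑ j ∈ tail hX, t * (1 / (t + gap hX j)) ≤ ∑ j ∈ tail hX, (1 : ℝ) := by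
        refine Finset.sum_le_sum fun j hj => ?_
        have := hg j hj
        rw [mul_one_div, div_le_one (by linarith)]
        linarith
    _ = _ := by simp

/-- This Lipschitz bound keeps `t₀` away from zero once `1/ε₀ - 1/ε` is bounded below. -/
theorem invMean_zero_sub_le (ht : 0 ≤ t) : invMean hX 0 - invMean hX t ≤ t / γ ^ 2 := by
  rcases Nat.eq_zero_or_pos n with rfl | hn
  · simp only [invMean, CharP.cast_eq_zero, div_zero, zero_mul, sub_zero]
    positivity
  have hn' : (0 : ℝ) < n := by exact_mod_cast hn
  rw [invMean, invMean, ← mul_sub, ← Finset.sum_sub_distrib]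
  calc _ ≤ 1 / (n : ℝ) * ∑ j ∈ tail hX, t / γ ^ 2 := by
        refine mul_le_mul_of_nonneg_left (Finset.sum_le_sum fun j hj => ?_) (by positivity)
        have h1 : γ ≤ 0 + gap hX j := by linarith [hg j hj]
        have h2 : γ ≤ t + gap hX j := by linarith [hg j hj]
        have h3 : 0 + gap hX j ≠ 0 := by linarith
        have h4 : t + gap hX j ≠ 0 := by linarith
        rw [div_sub_div _ _ h3 h4, show 1 * (t + gap hX j) - (0 + gap hX j) * 1 = t by ring]
        refine div_le_div₀ ht (by linarith) (by positivity) ?_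
        rw [sq]
        exact mul_le_mul h1 h2 hγ.le (by linarith)
    _ ≤ 1 / (n : ℝ) * (n * (t / γ ^ 2)) := by
        rw [Finset.sum_const, nsmul_eq_mul]
        exact mul_le_mul_of_nonneg_left
          (mul_le_mul_of_nonneg_right card_tail_le (by positivity)) (by positivity)
    _ = _ := by field_simp

theorem invSqMean_le (ht : 0 ≤ t) : invSqMean hX t ≤ 1 / γ ^ 2 := by
  rcases Nat.eq_zero_or_pos n with rfl | hn
  · simp only [invSqMean, CharP.cast_eq_zero, div_zero, zero_mul]
    positivity
  have hn' : (0 : ℝ) < n := by exact_mod_cast hn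
  calc invSqMean hX t ≤ 1 / (n : ℝ) * ∑ j ∈ tail hX, 1 / γ ^ 2 := by
        refine mul_le_mul_of_nonneg_left (Finset.sum_le_sum fun j hj => ?_) (by positivity)
        have h2 : γ ≤ t + gap hX j := by linarith [hg j hj]
        gcongr
    _ ≤ 1 / (n : ℝ) * (n * (1 / γ ^ 2)) := by
        rw [Finset.sum_const, nsmul_eq_mul]
        exact mul_le_mul_of_nonneg_left
          (mul_le_mul_of_nonneg_right card_tail_le (by positivity)) (by positivity)
    _ = _ := by field_simp

theorem continuousOn_invMean : ContinuousOn (invMean hX) (Set.Ici 0) := by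
  unfold invMean
  refine continuousOn_const.mul (continuousOn_finsetSum _ fun j hj => ?_)
  refine continuousOn_const.div (by fun_prop) fun t ht => ?_
  have h1 : 0 ≤ t := ht
  linarith [hg j hj]

/-- The supercritical equation has exactly one positive solution. -/
theorem existsUnique_invMean_eq (h : topMult hX < n) {ε : ℝ} (hε : 0 < ε)
    (hlt : 1 / ε < invMean hX 0) : ∃! t : ℝ, 0 < t ∧ 1 / ε = invMean hX t := by
  have hn : 0 < n := (Nat.zero_le _).trans_lt h
  -- As `t * invMean t ≤ 1`, the point `2ε` lies beyond the root and closes the interval for the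
  -- intermediate value theorem.
  have hT : invMean hX (2 * ε) ≤ 1 / ε := by
    have h1 := mul_invMean_le hγ hg hn (by positivity : 0 ≤ 2 * ε)
    have h2 : (0 : ℝ) ≤ (topMult hX : ℝ) / n := by positivity
    have h3 := invMean_pos hγ hg h (by positivity : 0 ≤ 2 * ε)
    rw [le_div_iff₀ hε]
    nlinarith
  obtain ⟨t, ht, hte⟩ := intermediate_value_Icc' (by positivity : 0 ≤ 2 * ε)
    ((continuousOn_invMean hγ hg).mono Set.Icc_subset_Ici_self) ⟨hT, hlt.le⟩
  have ht0 : 0 < t := ht.1.lt_of_ne fun h0 => by rw [← h0] at hte; linarith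
  refine ⟨t, ⟨ht0, hte.symm⟩, fun s hs => ?_⟩
  rcases lt_trichotomy s t with h1 | h1 | h1
  · have := invMean_lt_invMean hγ hg h hs.1.le h1
    linarith [hs.2]
  · exact h1
  · have := invMean_lt_invMean hγ hg h ht0.le h1
    linarith [hs.2]

end InvMean

/-! ### The three regimes at a fixed size, on the event that the controls are at most `M` -/

section FixedSize

variable {n : ℕ} {X : Matrix (Fin n) (Fin n) ℝ} {hX : X.IsHermitian}
  {b : OrthonormalBasis (Fin n) ℝ (EuclideanSpace ℝ (Fin n))} {l : ℕ} {γ e K ε M : ℝ}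
  {v : EuclideanSpace ℝ (Fin n)}

theorem one_div_epsCrit : 1 / epsCrit hX = invMean hX 0 := one_div_one_div _

theorem Regular.pos (h : Regular hX l γ e K ε) : 0 < n := (Nat.zero_le _).trans_lt h.topMult_lt

theorem Regular.eps_pos (h : Regular hX l γ e K ε) : 0 < ε := h.e_pos.trans_le h.le_eps

theorem Regular.K_pos (h : Regular hX l γ e K ε) : 0 < K := h.eps_pos.trans_le h.eps_le

theorem one_div_sqrt_pos (hn : 0 < n) : 0 < 1 / √(n : ℝ) := by
  have hn' : (0 : ℝ) < n := by exact_mod_cast hn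
  positivity

theorem one_div_sqrt_sq (n : ℕ) : (1 / √(n : ℝ)) ^ 2 = 1 / (n : ℝ) := by
  rw [div_pow, Real.sq_sqrt n.cast_nonneg, one_pow]

theorem one_div_sqrt_le_one (hn : 0 < n) : 1 / √(n : ℝ) ≤ 1 := by
  have hn' : (1 : ℝ) ≤ n := by exact_mod_cast hn
  rw [div_le_one (by positivity)]
  exact Real.one_le_sqrt.2 hn'

/-- The a priori bound comes from `μ/ε = χ²/n + μ F(μ)`, where both terms are at most `M`. -/
theorem Regular.secular_le (h : Regular hX l γ e K ε) (hb : IsEigenbasis hX b)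
    (hχ : chiSq hX b v ≤ M) (hq : sqMean hX b v ≤ M) {μ : ℝ}
    (hμ : μ = lambdaMax (perturb X ε v) - lambdaMax X) :
    0 ≤ μ ∧ 0 ≤ 1 / ε - wMean hX b v μ ∧
      chiSq hX b v * (1 / √(n : ℝ)) ^ 2 = μ * (1 / ε - wMean hX b v μ) ∧ μ ≤ 2 * K * M := by
  obtain ⟨h1, h2, h3⟩ := secular hX hb h.pos h.eps_pos
    (fun j hj => h.γ_pos.trans_le (h.le_gap j hj)) v hμ
  refine ⟨h1, sub_nonneg.2 h2, by rw [one_div_sqrt_sq, ← h3, mul_one_div], ?_⟩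
  have h4 := mul_wMean_le hX b v h.γ_pos h.le_gap h1
  have h5 : chiSq hX b v / n ≤ M :=
    (div_le_self (chiSq_nonneg hX b v) (by exact_mod_cast h.pos)).trans hχ
  have h6 : μ / ε ≤ 2 * M := by
    rw [mul_sub, mul_one_div] at h3
    linarith
  rw [div_le_iff₀ h.eps_pos] at h6
  have hM : 0 ≤ M := (chiSq_nonneg hX b v).trans hχ
  calc μ ≤ 2 * M * ε := h6
    _ ≤ 2 * M * K := mul_le_mul_of_nonneg_left h.eps_le (by positivity)
    _ = _ := by ring

/-- Below this size of `1/√n` the quadratic mean at `t` is bounded away from zero. -/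
theorem Regular.le_wMean₂ (h : Regular hX l γ e K ε) (hM : 0 < M) (hq : sqMean hX b v ≤ M)
    {t : ℝ} (ht : 0 ≤ t) (hte : 1 / ε = invMean hX t) (hξ : |xi hX b t v| ≤ M)
    (hu : M * (1 / √(n : ℝ)) ≤ 1 / (2 * K)) : 1 / (4 * K ^ 2 * M) ≤ wMean₂ hX b v t t := by
  have hK := h.K_pos
  -- The deterministic part is `1/ε ≥ 1/K`, and the fluctuation removes at most half of it.
  have h1 : 1 / (2 * K) ≤ wMean hX b v t := by
    rw [wMean_eq_add_xi, ← hte]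
    have h2 : 1 / K ≤ 1 / ε := one_div_le_one_div_of_le h.eps_pos h.eps_le
    have h3 : -(M * (1 / √(n : ℝ))) ≤ xi hX b t v * (1 / √(n : ℝ)) := by
      rw [← neg_mul]
      exact mul_le_mul_of_nonneg_right (abs_le.1 hξ).1 (one_div_sqrt_pos h.pos).le
    have h4 : 1 / K = 2 * (1 / (2 * K)) := by field_simp
    linarith
  have h2 := wMean_sq_le hX b v (t := t)
  have h3 : (1 / (2 * K)) ^ 2 ≤ wMean hX b v t ^ 2 := pow_le_pow_left₀ (by positivity) h1 2
  have h4 := mul_le_mul_of_nonneg_right hq (wMean₂_nonneg hX b v h.γ_pos h.le_gap ht ht)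
  have h5 : (1 / (2 * K)) ^ 2 ≤ M * wMean₂ hX b v t t := h3.trans (h2.trans h4)
  rw [div_le_iff₀ (by positivity)]
  calc (1 : ℝ) = (1 / (2 * K)) ^ 2 * (4 * K ^ 2) := by field_simp; norm_num
    _ ≤ M * wMean₂ hX b v t t * (4 * K ^ 2) := mul_le_mul_of_nonneg_right h5 (by positivity)
    _ = _ := by ring

theorem Regular.subcritical (h : Regular hX l γ e K ε) (hb : IsEigenbasis hX b)
    (hχ : chiSq hX b v ≤ M) (hq : sqMean hX b v ≤ M) (hξ : |xi hX b 0 v| ≤ M) {d : ℝ} (hd : 0 < d)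
    (hD : d ≤ 1 / ε - 1 / epsCrit hX) (hu : M * (1 / √(n : ℝ)) ≤ d / 2) :
    |lambdaMax (perturb X ε v) - (lambdaMax X + subW₁ hX b ε v / n
      + subW₂ hX b ε v / (n : ℝ) ^ (3 / 2 : ℝ))| ≤
      M * (2 * (M + M / γ ^ 2) ^ 2 + 2 * M * (M / γ ^ 2)) / d ^ 3 * |1 / (n : ℝ) ^ 2| := by
  have hn' : (0 : ℝ) < n := by exact_mod_cast h.pos
  have hM : 0 ≤ M := (chiSq_nonneg hX b v).trans hχ
  obtain ⟨h1, h2, h3, -⟩ := h.secular_le hb hχ hq rfl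
  set μ := lambdaMax (perturb X ε v) - lambdaMax X with hμ
  have h4 := wMean_sub_wMean hX b v h.γ_pos h.le_gap le_rfl h1
  have hB := wMean₂_le hX b v h.γ_pos h.le_gap le_rfl h1
  have hB0 := wMean₂_nonneg hX b v h.γ_pos h.le_gap le_rfl h1
  rw [sub_zero] at h4
  have hγ := h.γ_pos
  have hBM : wMean₂ hX b v 0 μ ≤ M / γ ^ 2 := hB.trans (by gcongr)
  have h5 := wMean_eq_add_xi hX b v (t := 0)
  have key := subcritical_expansion hd (one_div_sqrt_pos h.pos) hD (chiSq_nonneg hX b v) hχ hξ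
    (by positivity : 0 ≤ M / γ ^ 2) h1 (mul_nonneg h1 hB0) (mul_le_mul_of_nonneg_left hBM h1) hu
    (by rw [h3, one_div_epsCrit]; congr 1; linarith)
  have h6 : (n : ℝ) ^ (3 / 2 : ℝ) = n * √(n : ℝ) := by
    rw [Real.sqrt_eq_rpow, ← Real.rpow_one_add' hn'.le (by norm_num)]
    norm_num
  have h7 : (1 / √(n : ℝ)) ^ 3 = 1 / (n * √(n : ℝ)) := by
    rw [pow_succ, one_div_sqrt_sq, div_mul_div_comm, one_mul]
  have h8 : (1 / √(n : ℝ)) ^ 4 = 1 / (n : ℝ) ^ 2 := by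
    rw [show 4 = 2 * 2 from rfl, pow_mul, one_div_sqrt_sq, div_pow, one_pow]
  rw [h7, h8, one_div_sqrt_sq] at key
  rw [abs_of_nonneg (by positivity : 0 ≤ 1 / (n : ℝ) ^ 2)]
  convert key using 2
  rw [hμ, subW₂, subW₁, h6]
  ring

theorem Regular.critical (h : Regular hX l γ e K ε) (hb : IsEigenbasis hX b) (hM : 0 < M)
    (hχ : chiSq hX b v ≤ M) (hq : sqMean hX b v ≤ M) (hξ : |xi hX b 0 v| ≤ M)
    (hε : ε = epsCrit hX) (hu : M * (1 / √(n : ℝ)) ≤ 1 / (2 * K)) :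
    |lambdaMax (perturb X ε v) - (lambdaMax X + critW hX b v / √(n : ℝ))| ≤
      (1 + 2 * M * (4 * K ^ 2 * M * (1 + 2 * K * M / γ))) ^ 2 / γ * |1 / (n : ℝ)| := by
  have hn' : (0 : ℝ) < n := by exact_mod_cast h.pos
  have hγ := h.γ_pos
  have hK := h.K_pos
  have hεc : 1 / ε = invMean hX 0 := by rw [hε, one_div_epsCrit]
  have hupos := one_div_sqrt_pos h.pos
  set u := 1 / √(n : ℝ) with hu_def
  obtain ⟨h1, h2, h3, h4⟩ := h.secular_le hb hχ hq rfl
  set μ := lambdaMax (perturb X ε v) - lambdaMax X with hμ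
  have hlow := h.le_wMean₂ hM hq le_rfl hεc hξ hu
  have hζ : 0 < wMean₂ hX b v 0 0 := lt_of_lt_of_le (by positivity) hlow
  have hF := wMean_sub_wMean hX b v h.γ_pos h.le_gap le_rfl h1
  have hF0 := wMean_eq_add_xi hX b v (t := 0)
  rw [← hu_def] at h3 hF0
  rw [sub_zero] at hF
  have hcmp := wMean₂_self_le hX b v h.γ_pos h.le_gap le_rfl h1
  have hdiff := abs_wMean₂_sub_le hX b v h.γ_pos h.le_gap le_rfl h1
  rw [sub_zero, abs_of_nonneg h1] at hdiff
  -- At criticality `μ` lives on the scale `1/√n`.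
  set m := μ / u with hm
  have hμm : μ = m * u := by rw [hm]; field_simp
  have hm0 : 0 ≤ m := div_nonneg h1 hupos.le
  have hrest : 1 / ε - wMean hX b v μ = u * (m * wMean₂ hX b v 0 μ - xi hX b 0 v) := by
    rw [hεc]
    linear_combination hF - hF0 + (hμm) * wMean₂ hX b v 0 μ
  have e1 : chiSq hX b v = m * (m * wMean₂ hX b v 0 μ - xi hX b 0 v) := by
    rw [hrest, hμm] at h3
    have hu2 : u ^ 2 ≠ 0 := by positivity
    apply mul_right_cancel₀ hu2
    rw [hμm, h3]; ring
  have e2 : xi hX b 0 v ≤ m * wMean₂ hX b v 0 μ := by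
    rw [hrest] at h2
    exact sub_nonneg.1 (nonneg_of_mul_nonneg_right h2 hupos)
  have hfin := critical_expansion (κ := u / γ) hm0 (chiSq_nonneg hX b v) hζ
    (hdiff.trans_eq (by rw [hμm]; ring)) e1 e2
  rw [← zetaOne_eq] at hfin
  -- `1/a` bounds `wMean₂ 0 μ` from below: the diagonal bound `1/(4K²M)` divided by the comparison
  -- factor at `μ ≤ 2KM`.
  set a := 4 * K ^ 2 * M * (1 + 2 * K * M / γ) with ha
  have ha0 : 0 < a := by positivity
  have hζ' : 1 ≤ a * wMean₂ hX b v 0 μ := by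
    have h5 : wMean₂ hX b v 0 0 ≤ (1 + 2 * K * M / γ) * wMean₂ hX b v 0 μ := by
      refine hcmp.trans (mul_le_mul_of_nonneg_right ?_
        (wMean₂_nonneg hX b v h.γ_pos h.le_gap le_rfl h1))
      gcongr
    rw [div_le_iff₀ (by positivity)] at hlow
    rw [ha, mul_assoc, mul_comm]
    exact hlow.trans (mul_le_mul_of_nonneg_right h5 (by positivity))
  have hmle : m ≤ 1 + 2 * M * a := by
    -- If `m ≥ 1`, the equation for `χ²` gives `m G - ξ ≤ χ² ≤ M`, hence `m G ≤ 2M` with `G ≥ 1/a`.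
    rcases le_total m 1 with h6 | h6
    · exact h6.trans (by linarith [mul_pos (mul_pos two_pos hM) ha0])
    · have h7 : m * wMean₂ hX b v 0 μ - xi hX b 0 v ≤ M := by
        refine le_trans ?_ hχ
        rw [e1]
        exact le_mul_of_one_le_left (sub_nonneg.2 e2) h6
      have h8 : m * wMean₂ hX b v 0 μ ≤ 2 * M := by linarith [(abs_le.1 hξ).2]
      have h9 : m * 1 ≤ m * (a * wMean₂ hX b v 0 μ) := mul_le_mul_of_nonneg_left hζ' hm0
      have h10 : a * (m * wMean₂ hX b v 0 μ) ≤ a * (2 * M) := mul_le_mul_of_nonneg_left h8 ha0.le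
      linarith
  have hfinal : lambdaMax (perturb X ε v) - (lambdaMax X + critW hX b v / √(n : ℝ)) =
      u * (m - critW hX b v) := by
    have : critW hX b v / √(n : ℝ) = critW hX b v * u := by rw [hu_def]; ring
    rw [this]
    linear_combination hμm - hμ
  rw [hfinal, abs_mul, abs_of_pos hupos, abs_of_pos (by positivity : 0 < 1 / (n : ℝ)),
    ← one_div_sqrt_sq, ← hu_def]
  calc u * |m - critW hX b v| ≤ u * (m ^ 2 * (u / γ)) := mul_le_mul_of_nonneg_left hfin hupos.le
    _ ≤ u * ((1 + 2 * M * a) ^ 2 * (u / γ)) := by gcongr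
    _ = _ := by ring

theorem Regular.supercritical (h : Regular hX l γ e K ε) (hb : IsEigenbasis hX b) (hM : 0 < M)
    {t c : ℝ} (hc : 0 < c) (ht : c ≤ t) (hte : 1 / ε = invMean hX t)
    (hχ : chiSq hX b v ≤ M) (hq : sqMean hX b v ≤ M) (hξ : |xi hX b t v| ≤ M)
    (hη : |eta hX b t v| ≤ M) (hu : M * (1 / √(n : ℝ)) ≤ 1 / (2 * K)) {a : ℝ}
    (ha : a = 1 / (4 * K ^ 2 * M) / (1 + 2 * K * M / γ))
    (hu' : M / a * (1 / √(n : ℝ)) ≤ c / 2) :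
    |lambdaMax (perturb X ε v) - (lambdaMax X + t + superW hX b t v / √(n : ℝ))| ≤
      (2 * M / c + (M + 2 * M / c) / a * ((M + 2 * M / c) / a * M / γ ^ 3 + M)) / (1 / K ^ 2) *
        |1 / (n : ℝ)| := by
  have hn' : (0 : ℝ) < n := by exact_mod_cast h.pos
  have hγ := h.γ_pos
  have hK := h.K_pos
  have ht0 : 0 ≤ t := hc.le.trans ht
  obtain ⟨h1, h2, h3, h4⟩ := h.secular_le hb hχ hq rfl
  set μ := lambdaMax (perturb X ε v) - lambdaMax X with hμ
  have hlow := h.le_wMean₂ hM hq ht0 hte hξ hu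
  have hF := wMean_sub_wMean hX b v h.γ_pos h.le_gap ht0 h1
  have hF0 := wMean_eq_add_xi hX b v (t := t)
  have hcmp := wMean₂_self_le hX b v h.γ_pos h.le_gap ht0 h1
  have hdiff := abs_wMean₂_sub_le hX b v h.γ_pos h.le_gap ht0 h1
  have hA0 := wMean₂_nonneg hX b v h.γ_pos h.le_gap ht0 h1
  have hB0 := wMean₂_nonneg hX b v h.γ_pos h.le_gap ht0 ht0
  have ha0 : 0 < a := by rw [ha]; positivity
  have hA : a ≤ wMean₂ hX b v t μ := by
    rw [ha, div_le_iff₀ (by positivity), mul_comm (wMean₂ hX b v t μ)]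
    refine hlow.trans (hcmp.trans (mul_le_mul_of_nonneg_right ?_ hA0))
    gcongr
  have hB : |wMean₂ hX b v t t| ≤ M / γ ^ 2 := by
    rw [abs_of_nonneg hB0]
    exact (wMean₂_le hX b v h.γ_pos h.le_gap ht0 ht0).trans (by gcongr)
  have hζ : 1 / K ^ 2 ≤ invSqMean hX t := by
    refine le_trans ?_ invMean_sq_le
    rw [← hte, ← _root_.one_div_pow]
    exact pow_le_pow_left₀ (by positivity) (one_div_le_one_div_of_le h.eps_pos h.eps_le) 2
  have key := supercritical_expansion (y := μ - t) (ρ := 1 / ε - wMean hX b v μ) ha0 hc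
    (by positivity : 0 < 1 / K ^ 2) hγ (one_div_sqrt_pos h.pos) (one_div_sqrt_le_one h.pos)
    (chiSq_nonneg hX b v) hχ hξ hη h2 ht hA hB hζ (wMean₂_eq_add_eta hX b v) hdiff
    (by rwa [mul_div_right_comm]) (by rw [← hF, hF0, hte]; ring)
    (by rw [h3]; ring)
  rw [one_div_sqrt_sq] at key
  rw [abs_of_pos (by positivity : 0 < 1 / (n : ℝ))]
  convert key using 2
  rw [hμ, superW]
  ring

end FixedSize

end RankOne

namespace RankOne

/-! ### Boundedness in probability of the statistics -/

section Assembly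

variable {Ω : ℕ → Type*} [∀ n, MeasurableSpace (Ω n)] {P : ∀ n, Measure (Ω n)}
  [∀ n, IsProbabilityMeasure (P n)] {X : ∀ n, Matrix (Fin n) (Fin n) ℝ}
  {hX : ∀ n, (X n).IsHermitian} {z : ∀ n, Ω n → EuclideanSpace ℝ (Fin n)}
  {b : ∀ n, OrthonormalBasis (Fin n) ℝ (EuclideanSpace ℝ (Fin n))}
  {l : ℕ} {γ e K : ℝ} {ε : ℕ → ℝ}

theorem isBigOP_chiSq (hz : ∀ n, HasLaw (z n) (stdGaussian (EuclideanSpace ℝ (Fin n))) (P n))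
    (hl : ∀ᶠ n in atTop, topMult (hX n) ≤ l) :
    IsBigOP P (fun n ω => chiSq (hX n) (b n) (z n ω)) fun _ => 1 := by
  have h := isBigOP_sum_sq (fun n j => hasLaw_coord (hz n) (b n) j) (fun _ => 1)
    (fun _ => zero_le_one) (fun n => head (hX n)) l
    (hl.mono fun n hn => by rw [card_head, one_mul]; exact_mod_cast hn)
  simpa only [one_mul, chiSq] using h

theorem isBigOP_sqMean (hz : ∀ n, HasLaw (z n) (stdGaussian (EuclideanSpace ℝ (Fin n))) (P n)) :
    IsBigOP P (fun n ω => sqMean (hX n) (b n) (z n ω)) fun _ => 1 := by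
  refine isBigOP_sum_sq (fun n j => hasLaw_coord (hz n) (b n) j) (fun n => 1 / (n : ℝ))
    (fun _ => by positivity) (fun n => tail (hX n)) 1 ?_
  filter_upwards with n
  rw [one_div_mul_eq_div]
  exact div_le_one_of_le₀ card_tail_le n.cast_nonneg

theorem isBigOP_xi (hz : ∀ n, HasLaw (z n) (stdGaussian (EuclideanSpace ℝ (Fin n))) (P n))
    (hR : ∀ᶠ n in atTop, Regular (hX n) l γ e K (ε n)) (t : ℕ → ℝ) (ht : ∀ᶠ n in atTop, 0 ≤ t n) :
    IsBigOP P (fun n ω => xi (hX n) (b n) (t n) (z n ω)) fun _ => 1 := by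
  have h := isBigOP_weighted_sum (fun n j => hasLaw_coord (hz n) (b n) j)
    (fun n => iIndepFun_coord (hz n) (b n)) (fun n j => 1 / (t n + gap (hX n) j))
    (fun n => tail (hX n)) (1 / γ) (by
      filter_upwards [hR, ht] with n hn htn j hj
      have h1 := hn.le_gap j hj
      have h2 := hn.γ_pos
      rw [abs_of_nonneg (by apply one_div_nonneg.2; linarith)]
      exact one_div_le_one_div_of_le h2 (by linarith))
  simpa only [one_div_mul_eq_div (_ + _), xi] using h

theorem isBigOP_eta (hz : ∀ n, HasLaw (z n) (stdGaussian (EuclideanSpace ℝ (Fin n))) (P n))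
    (hR : ∀ᶠ n in atTop, Regular (hX n) l γ e K (ε n)) (t : ℕ → ℝ) (ht : ∀ᶠ n in atTop, 0 ≤ t n) :
    IsBigOP P (fun n ω => eta (hX n) (b n) (t n) (z n ω)) fun _ => 1 := by
  have h := isBigOP_weighted_sum (fun n j => hasLaw_coord (hz n) (b n) j)
    (fun n => iIndepFun_coord (hz n) (b n)) (fun n j => 1 / (t n + gap (hX n) j) ^ 2)
    (fun n => tail (hX n)) (1 / γ ^ 2) (by
      filter_upwards [hR, ht] with n hn htn j hj
      have h1 := hn.le_gap j hj
      have h2 := hn.γ_pos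
      rw [abs_of_nonneg (by positivity)]
      exact one_div_le_one_div_of_le (by positivity)
        (pow_le_pow_left₀ h2.le (by linarith) 2))
  simpa only [one_div_mul_eq_div (_ ^ 2), eta] using h

theorem isBigOP_zetaOne (hz : ∀ n, HasLaw (z n) (stdGaussian (EuclideanSpace ℝ (Fin n))) (P n))
    (hR : ∀ᶠ n in atTop, Regular (hX n) l γ e K (ε n)) :
    IsBigOP P (fun n ω => zetaOne (hX n) (b n) (z n ω)) fun _ => 1 := by
  refine (isBigOP_sqMean (hX := hX) (b := b) hz).of_control fun M _ => ⟨M / γ ^ 2, ?_⟩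
  filter_upwards [hR] with n hn ω hω
  have hγ := hn.γ_pos
  rw [abs_of_nonneg (sqMean_nonneg _ _ _)] at hω
  rw [zetaOne_eq, abs_of_nonneg (wMean₂_nonneg _ _ _ hγ hn.le_gap le_rfl le_rfl), abs_one, mul_one]
  exact (wMean₂_le _ _ _ hγ hn.le_gap le_rfl le_rfl).trans (by gcongr)

end Assembly

/-- Only `1/ε₀ ≤ 1/(ε + c)` is needed, so no upper bound on `ε₀` enters. -/
theorem subcritical_gap {ε ε₀ c K : ℝ} (hε : 0 < ε) (hK : ε ≤ K) (hc : 0 < c) (h : c ≤ ε₀ - ε) :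
    c / (K * (K + c)) ≤ 1 / ε - 1 / ε₀ := by
  have h1 : 1 / ε₀ ≤ 1 / (ε + c) := one_div_le_one_div_of_le (by linarith) (by linarith)
  have h2 : 1 / ε - 1 / (ε + c) = c / (ε * (ε + c)) := by
    field_simp
    ring
  have hK0 : 0 ≤ K := hε.le.trans hK
  have h3 : c / (K * (K + c)) ≤ c / (ε * (ε + c)) := by gcongr
  linarith

theorem supercritical_gap {ε ε₀ c K : ℝ} (hε₀ : 0 < ε₀) (hK : ε ≤ K) (hc : 0 < c)
    (h : c ≤ ε - ε₀) : c / K ^ 2 ≤ 1 / ε₀ - 1 / ε := by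
  have h0 : 0 < ε := by linarith
  rw [div_sub_div _ _ hε₀.ne' h0.ne']
  refine div_le_div₀ (by linarith) (by linarith) (by positivity) ?_
  rw [sq]
  exact mul_le_mul (by linarith) hK h0.le (by linarith)

end RankOne

theorem mainTheorem3
    {Ω : ℕ → Type*} [∀ n, MeasurableSpace (Ω n)]
    (P : ∀ n, Measure (Ω n)) [∀ n, IsProbabilityMeasure (P n)]
    -- the symmetric matrices, the perturbation sizes and the standard Gaussian vectors
    (X : ∀ n, Matrix (Fin n) (Fin n) ℝ) (hX : ∀ n, (X n).IsHermitian)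
    (ε : ℕ → ℝ)
    (z : ∀ n, Ω n → EuclideanSpace ℝ (Fin n))
    (hz : ∀ n, HasLaw (z n) (stdGaussian (EuclideanSpace ℝ (Fin n))) (P n))
    -- any ordered orthonormal eigenbases
    (b : ∀ n, OrthonormalBasis (Fin n) ℝ (EuclideanSpace ℝ (Fin n)))
    (hb : ∀ n, RankOne.IsEigenbasis (hX n) (b n))
    -- A1
    (l : ℕ) (hl : ∀ᶠ n in atTop, RankOne.topMult (hX n) ≤ l)
    (γ : ℝ) (hγ : 0 < γ)
    (hgap : ∀ᶠ n in atTop, ∃ h : RankOne.topMult (hX n) < n,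
      γ ≤ RankOne.gap (hX n) ⟨RankOne.topMult (hX n), h⟩)
    -- A2
    (hε_inf : (0 : EReal) < liminf (fun n => (ε n : EReal)) atTop)
    (hε_sup : limsup (fun n => (ε n : EReal)) atTop < ⊤)
    -- A3
    (C : ℝ)
    (hC : ∀ᶠ n in atTop, RankOne.invSqMean (hX n) 0 < 1 / γ ^ 2 ∧
      RankOne.invSqMean (hX n) (ε n) < RankOne.invSqMean (hX n) 0 ∧
      C < RankOne.invSqMean (hX n) (ε n)) :
    -- the coordinates in the eigenbasis are i.i.d. standard normal
    (∀ n, iIndepFun (fun j ω => RankOne.coord (b n) (z n ω) j) (P n) ∧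
      ∀ j, HasLaw (fun ω => RankOne.coord (b n) (z n ω) j) (gaussianReal 0 1) (P n)) ∧
    RankOne.IsBigOP P (fun n ω => RankOne.xi (hX n) (b n) 0 (z n ω)) (fun _ => 1) ∧
    RankOne.IsBigOP P (fun n ω => RankOne.zetaOne (hX n) (b n) (z n ω)) (fun _ => 1) ∧
    -- below the critical value
    ((∀ᶠ n in atTop, 0 < ε n ∧ ε n < RankOne.epsCrit (hX n)) →
      (0 : EReal) < liminf (fun n => ((RankOne.epsCrit (hX n) - ε n : ℝ) : EReal)) atTop →
      RankOne.IsBigOP P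
        (fun n ω => RankOne.lambdaMax (RankOne.perturb (X n) (ε n) (z n ω))
          - (RankOne.lambdaMax (X n)
            + RankOne.subW₁ (hX n) (b n) (ε n) (z n ω) / n
            + RankOne.subW₂ (hX n) (b n) (ε n) (z n ω) / (n : ℝ) ^ (3 / 2 : ℝ)))
        (fun n => 1 / (n : ℝ) ^ 2)) ∧
    -- at the critical value
    ((∀ᶠ n in atTop, ε n = RankOne.epsCrit (hX n)) →
      RankOne.IsBigOP P
        (fun n ω => RankOne.lambdaMax (RankOne.perturb (X n) (ε n) (z n ω))
          - (RankOne.lambdaMax (X n) + RankOne.critW (hX n) (b n) (z n ω) / √(n : ℝ)))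
        (fun n => 1 / (n : ℝ))) ∧
    -- above the critical value
    ((∀ᶠ n in atTop, RankOne.epsCrit (hX n) < ε n) →
      (0 : EReal) < liminf (fun n => ((ε n - RankOne.epsCrit (hX n) : ℝ) : EReal)) atTop →
      (∀ᶠ n in atTop, ∃! t : ℝ, 0 < t ∧ 1 / ε n = RankOne.invMean (hX n) t) ∧
      ∀ t₀ : ℕ → ℝ,
        (∀ᶠ n in atTop, 0 < t₀ n ∧ 1 / ε n = RankOne.invMean (hX n) (t₀ n)) →
        (∀ᶠ n in atTop, t₀ n ≤ (1 - (RankOne.topMult (hX n) : ℝ) / n) * ε n) ∧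
        RankOne.IsBigOP P (fun n ω => RankOne.xi (hX n) (b n) (t₀ n) (z n ω)) (fun _ => 1) ∧
        (fun n => RankOne.invSqMean (hX n) (t₀ n)) =O[atTop] (fun _ => (1 : ℝ)) ∧
        RankOne.IsBigOP P
          (fun n ω => RankOne.lambdaMax (RankOne.perturb (X n) (ε n) (z n ω))
            - (RankOne.lambdaMax (X n) + t₀ n
              + RankOne.superW (hX n) (b n) (t₀ n) (z n ω) / √(n : ℝ)))
          (fun n => 1 / (n : ℝ))) := by
  obtain ⟨e, he, heε⟩ := RankOne.exists_pos_le_of_liminf hε_inf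
  obtain ⟨K, hK, hεK⟩ := RankOne.exists_pos_ge_of_limsup hε_sup
  have hR : ∀ᶠ n in atTop, RankOne.Regular (hX n) l γ e K (ε n) := by
    filter_upwards [hl, hgap, heε, hεK] with n h1 h2 h3 h4
    obtain ⟨h5, h6⟩ := h2
    exact ⟨hγ, he, h1, h5, fun j hj => h6.trans (RankOne.gap_mono (hX n)
      (Fin.mk_le_of_le_val (by simpa [RankOne.tail] using hj))), h3, h4⟩
  have hχP := RankOne.isBigOP_chiSq (b := b) hz hl
  have hqP := RankOne.isBigOP_sqMean (hX := hX) (b := b) hz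
  have hξP := RankOne.isBigOP_xi (b := b) hz hR (fun _ => 0) (Eventually.of_forall fun _ => le_rfl)
  -- A single control variable: bounding the sum of absolute values bounds each summand.
  have hS := (hχP.abs.add hqP.abs).add hξP.abs
  have hcrit : ∀ᶠ n in atTop, 0 < RankOne.epsCrit (hX n) := hR.mono fun n hn =>
    one_div_pos.2 (RankOne.invMean_pos hγ hn.le_gap hn.topMult_lt le_rfl)
  refine ⟨fun n => ⟨RankOne.iIndepFun_coord (hz n) (b n), RankOne.hasLaw_coord (hz n) (b n)⟩,
    hξP, RankOne.isBigOP_zetaOne hz hR, fun _ hsub => ?_, fun hε => ?_, fun hsup hsup' => ?_⟩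
  · obtain ⟨c, hc, hcε⟩ := RankOne.exists_pos_le_of_liminf hsub
    have hd : 0 < c / (K * (K + c)) := by positivity
    refine hS.of_control fun M hM => ⟨M * (2 * (M + M / γ ^ 2) ^ 2 + 2 * M * (M / γ ^ 2))
      / (c / (K * (K + c))) ^ 3, ?_⟩
    · filter_upwards [hR, hcε, RankOne.eventually_mul_one_div_sqrt_le M (half_pos hd)]
        with n hn h1 h2 ω hω
      have hω' := (le_abs_self _).trans hω
      have a1 := abs_nonneg (RankOne.chiSq (hX n) (b n) (z n ω))
      have a2 := abs_nonneg (RankOne.sqMean (hX n) (b n) (z n ω))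
      have a3 := abs_nonneg (RankOne.xi (hX n) (b n) 0 (z n ω))
      exact hn.subcritical (hb n) ((le_abs_self _).trans (by linarith))
        ((le_abs_self _).trans (by linarith)) (by linarith) hd
        (RankOne.subcritical_gap hn.eps_pos hn.eps_le hc h1) h2
  -- `M + 1` replaces `M` because the fixed-size bound requires a strictly positive level.
  · refine hS.of_control fun M hM =>
      ⟨(1 + 2 * (M + 1) * (4 * K ^ 2 * (M + 1) * (1 + 2 * K * (M + 1) / γ))) ^ 2 / γ, ?_⟩
    · filter_upwards [hR, hε, RankOne.eventually_mul_one_div_sqrt_le (M + 1)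
        (by positivity : 0 < 1 / (2 * K))] with n hn h1 h2 ω hω
      have hω' := (le_abs_self _).trans hω
      have a1 := abs_nonneg (RankOne.chiSq (hX n) (b n) (z n ω))
      have a2 := abs_nonneg (RankOne.sqMean (hX n) (b n) (z n ω))
      have a3 := abs_nonneg (RankOne.xi (hX n) (b n) 0 (z n ω))
      exact hn.critical (hb n) (by positivity : 0 < M + 1) ((le_abs_self _).trans (by linarith))
        ((le_abs_self _).trans (by linarith)) (by linarith) h1 h2
  obtain ⟨c, hc, hcε⟩ := RankOne.exists_pos_le_of_liminf hsup'
  refine ⟨?_, fun t₀ ht₀ => ?_⟩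
  · filter_upwards [hR, hsup, hcrit] with n hn h1 h2
    exact RankOne.existsUnique_invMean_eq hγ hn.le_gap hn.topMult_lt hn.eps_pos
      (RankOne.one_div_epsCrit (hX := hX n) ▸ one_div_lt_one_div_of_lt h2 h1)
  have ht0 : ∀ᶠ n in atTop, 0 ≤ t₀ n := ht₀.mono fun n hn => hn.1.le
  have hξtP := RankOne.isBigOP_xi (b := b) hz hR t₀ ht0
  have hηtP := RankOne.isBigOP_eta (b := b) hz hR t₀ ht0
  refine ⟨?_, hξtP, ?_, ?_⟩
  · filter_upwards [hR, ht₀] with n hn h1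
    have h2 := RankOne.mul_invMean_le hγ hn.le_gap hn.pos h1.1.le
    rwa [← h1.2, mul_one_div, div_le_iff₀ hn.eps_pos] at h2
  · refine Asymptotics.IsBigO.of_bound (1 / γ ^ 2) ?_
    filter_upwards [hR, ht0] with n hn h1
    have h2 : 0 ≤ RankOne.invSqMean (hX n) (t₀ n) := (sq_nonneg _).trans RankOne.invMean_sq_le
    rw [Real.norm_of_nonneg h2, norm_one, mul_one]
    exact RankOne.invSqMean_le hγ hn.le_gap h1
  -- This constant will bound `t₀` below: `c/K² ≤ 1/ε₀ - 1/ε ≤ t₀/γ²`.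
  · have hc' : 0 < c / K ^ 2 * γ ^ 2 := by positivity
    refine ((hχP.abs.add hqP.abs).add (hξtP.abs.add hηtP.abs)).of_control fun M hM => ?_
    obtain ⟨a, ha⟩ : ∃ a, a = 1 / (4 * K ^ 2 * (M + 1)) / (1 + 2 * K * (M + 1) / γ) := ⟨_, rfl⟩
    refine ⟨(2 * (M + 1) / (c / K ^ 2 * γ ^ 2) + ((M + 1) + 2 * (M + 1) / (c / K ^ 2 * γ ^ 2)) / a *
      (((M + 1) + 2 * (M + 1) / (c / K ^ 2 * γ ^ 2)) / a * (M + 1) / γ ^ 3 + (M + 1))) /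
      (1 / K ^ 2), ?_⟩
    · filter_upwards [hR, ht₀, hcε, hcrit, RankOne.eventually_mul_one_div_sqrt_le (M + 1)
        (by positivity : 0 < 1 / (2 * K)),
        RankOne.eventually_mul_one_div_sqrt_le ((M + 1) / a) (half_pos hc')]
        with n hn h1 h2 h3 h4 h5 ω hω
      have hω' := (le_abs_self _).trans hω
      have a1 := abs_nonneg (RankOne.chiSq (hX n) (b n) (z n ω))
      have a2 := abs_nonneg (RankOne.sqMean (hX n) (b n) (z n ω))
      have a3 := abs_nonneg (RankOne.xi (hX n) (b n) (t₀ n) (z n ω))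
      have a4 := abs_nonneg (RankOne.eta (hX n) (b n) (t₀ n) (z n ω))
      have h6 := RankOne.supercritical_gap h3 hn.eps_le hc h2
      have h7 := RankOne.invMean_zero_sub_le hγ hn.le_gap h1.1.le
      rw [RankOne.one_div_epsCrit, h1.2] at h6
      have h8 : c / K ^ 2 * γ ^ 2 ≤ t₀ n := (le_div_iff₀ (by positivity)).1 (h6.trans h7)
      exact hn.supercritical (hb n) (by positivity : 0 < M + 1) hc' h8 h1.2
        ((le_abs_self _).trans (by linarith)) ((le_abs_self _).trans (by linarith))
        (by linarith) (by linarith) h4 ha h5
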